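/- Let $D\subset\mathbb R^3$ be a bounded open set (for instance a bounded, connected domain with smooth boundary and outward normal $\nu$), $t_0<t_f$, $k_a,k_r>0$, $k_c<0$, $\lambda_a,\lambda_r,\lambda_c\neq 0$, $\kappa_p>0$. Let $U$ be Lipschitz on $\mathrm{cl}\,D$, and let $P\in C^2(\mathbb R)\cap\mathrm{Lip}(\mathbb R)$ satisfy $P'(s)\ge 0$ for $s\ge 0$ and be such that $v\mapsto\kappa_p v(1-P(\|v\|))$ is Lipschitz on $\mathbb R^3$. For $\alpha\in\{a,c,r\}$ put $G_\alpha(z)=k_\alpha e^{-|\lambda_\alpha|\|z\|}/\|z\|$ and $$\pi_\rho[\rho](x)=\int_D G_a(x-y)\rho(y)\,dy,\qquad \pi_{\mathbf j}[\mathbf j](x)=\int_D G_a(x-y)\mathbf j(y)\,dy,\qquad v_c[\rho](x)=\int_D G_c(x-y)\rho(y)\,dy,\qquad v_r[\rho](x)=\int_D G_r(x-y)\rho(y)\,dy.$$ Consider the Euler alignment system on $[t_0,t_f]\times D$ $$\partial_t\rho+\nabla_x\cdot\mathbf j=0,\qquad \partial_t\mathbf j+\nabla_x\cdot[\rho^{-1}\mathbf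 j\mathbf j^\top]=\mathbf S[\rho,\mathbf j],$$ $$\mathbf S[\rho,\mathbf j]=\rho\,\pi_{\mathbf j}[\mathbf j]-\mathbf j\,\pi_\rho[\rho]-\rho\nabla_x\big(v_c[\rho]+v_r[\rho]+U\big)+\kappa_p\,\mathbf j\,\big(1-P(\rho^{-1}\|\mathbf j\|)\big),$$ with $\mathbf j^\top\nu=0$ on $\partial D$ and initial data $(\rho_0,\mathbf j_0)$, where $\rho_0\in H^2(D)\cap\mathrm{Lip}(\mathrm{cl}\,D)$, $\rho_0>0$ on $\mathrm{cl}\,D$, and $\mathbf j_0\in\mathrm{Lip}(\mathrm{cl}\,D;\mathbb R^3)$. A pair $(\rho,\mathbf j)$ is called a *bounded-energy weak solution* if 1. $\rho\in C^3([t_0,t_f];H^2(D))\cap\mathrm{Lip}([t_0,t_f]\times\mathrm{cl}\,D)$, $\rho>0$ on $[t_0,t_f]\times\mathrm{cl}\,D$, and $\mathbf j\in C_w([t_0,t_f];L^2(D;\mathbb R^3))\cap L^\infty((t_0,t_f)\times D;\mathbb R^3)$; 2. $\rho(t_0,\cdot)=\rho_0$, $\mathbf j(t_0,\cdot)=\mathbf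 j_0$ a.e. in $D$, and for all $\phi\in C^\infty([t_0,t_f]\times\mathrm{cl}\,D;\mathbb R)$ and $\psi\in C^\infty([t_0,t_f]\times\mathrm{cl}\,D;\mathbb R^3)$ (restrictions of smooth functions on $\mathbb R\times\mathbb R^3$; this contains the weak form of the boundary condition) $$\int_D\rho\,\phi\,dx\Big|_{t_0}^{t_f}=\int_{t_0}^{t_f}\!\!\int_D\rho\,\partial_t\phi+\mathbf j^\top\nabla_x\phi\,dx\,dt,$$ $$\int_D\mathbf j^\top\psi\,dx\Big|_{t_0}^{t_f}=\int_{t_0}^{t_f}\!\!\int_D\mathbf j^\top\partial_t\psi+\langle\rho^{-1}\mathbf j\mathbf j^\top,\nabla_x\psi\rangle+\psi^\top\mathbf S[\rho,\mathbf j]\,dx\,dt;$$ 3. for a.e. $\tau\in[t_0,t_f]$ $$\frac12\int_D\rho^{-1}\mathbf j^\top\mathbf j+\rho\,v_r[\rho]+\rho\,v_c[\rho]\,dx\Big|_{t_0}^{\tau}\le\int_{t_0}^{\tau}\!\!\int_D\mathbf j^\top\pi_{\mathbf j}[\mathbf j]-\rho^{-1}\mathbf j^\top\mathbf j\,\pi_\rho[\rho]-\mathbf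 j^\top\nabla_xU+\kappa_p\rho^{-1}\mathbf j^\top\mathbf j\,\big(1-P(\|\rho^{-1}\mathbf j\|)\big)\,dx\,dt.$$ **Theorem (weak-strong uniqueness).** Fix a density $\rho\in C^3([t_0,t_f];H^2(D))\cap\mathrm{Lip}([t_0,t_f]\times\mathrm{cl}\,D)$ with $\rho>0$ on $[t_0,t_f]\times\mathrm{cl}\,D$ and $\rho(t_0,\cdot)=\rho_0$. Suppose there is a field $\mathbf i\in\mathrm{Lip}([t_0,t_f]\times\mathrm{cl}\,D;\mathbb R^3)$ with $\mathbf i(t_0,\cdot)=\mathbf j_0$ in $D$ such that $(\rho,\mathbf i)$ satisfies the continuity equation and the momentum equation a.e. in $(t_0,t_f)\times D$. Then every $\mathbf j$ for which $(\rho,\mathbf j)$ is a bounded-energy weak solution with data $(\rho_0,\mathbf j_0)$ satisfies $$\mathbf j=\mathbf i\quad\text{a.e. in }[t_0,t_f]\times D.$$ -/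

import Mathlib

open MeasureTheory Set
open scoped ContDiff RealInnerProductSpace

noncomputable section

namespace EulerAlignment

/-- Physical space `ℝ³` with its Euclidean norm. -/
abbrev R3 : Type := EuclideanSpace ℝ (Fin 3)

/-- The `a`-th standard basis vector. -/
def basisVec (a : Fin 3) : R3 := EuclideanSpace.single a 1

/-! ### Function spaces -/

/-- `g` is the weak partial derivative `∂ₐ f` on the open set `D`. -/
def IsWeakPartial (D : Set R3) (a : Fin 3) (f g : R3 → ℝ) : Prop :=
  ∀ η : R3 → ℝ, ContDiff ℝ ∞ η → HasCompactSupport η → tsupport η ⊆ D →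
    ∫ x in D, f x * fderiv ℝ η x (basisVec a) = -∫ x in D, g x * η x

/-- `f ∈ H²(D; ℝ)`. -/
def MemH2 (D : Set R3) (f : R3 → ℝ) : Prop :=
  MemLp f 2 (volume.restrict D) ∧
    ∃ (g : Fin 3 → R3 → ℝ) (h : Fin 3 → Fin 3 → R3 → ℝ),
      (∀ a, MemLp (g a) 2 (volume.restrict D) ∧ IsWeakPartial D a f (g a)) ∧
      ∀ a b, MemLp (h a b) 2 (volume.restrict D) ∧ IsWeakPartial D b (g a) (h a b)

/-- `ρ ∈ C³([t₀, t_f]; H²(D; ℝ))`. The map `f ↦ (f, ∇f, ∇²f)` identifies `H²(D)` isomorphically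
with a closed subspace of `L²(D)¹⁺³⁺⁹`, so a curve is `C³` in `H²(D)` exactly when it and its weak
derivatives of order one and two are `C³` curves in `L²(D)`. -/
def IsC3H2 (D : Set R3) (t₀ t_f : ℝ) (ρ : ℝ → R3 → ℝ) : Prop :=
  ∃ (r : ℝ → Lp ℝ 2 (volume.restrict D))
    (g : Fin 3 → ℝ → Lp ℝ 2 (volume.restrict D))
    (h : Fin 3 → Fin 3 → ℝ → Lp ℝ 2 (volume.restrict D)),
    ContDiffOn ℝ 3 r (Icc t₀ t_f) ∧
    (∀ a, ContDiffOn ℝ 3 (g a) (Icc t₀ t_f)) ∧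
    (∀ a b, ContDiffOn ℝ 3 (h a b) (Icc t₀ t_f)) ∧
    ∀ t ∈ Icc t₀ t_f,
      (r t : R3 → ℝ) =ᵐ[volume.restrict D] ρ t ∧
      (∀ a, IsWeakPartial D a (r t) (g a t)) ∧
      ∀ a b, IsWeakPartial D b (g a t) (h a b t)

/-- `f ∈ Lip([t₀, t_f] × cl D; F)`. -/
def IsLipSpaceTime {F : Type*} [PseudoEMetricSpace F] (D : Set R3) (t₀ t_f : ℝ)
    (f : ℝ → R3 → F) : Prop :=
  ∃ K, LipschitzOnWith K (Function.uncurry f) (Icc t₀ t_f ×ˢ closure D)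

/-! ### The system -/

/-- Domain, time interval, constants, confinement potential `U` and self-propulsion profile `P`. -/
structure System where
  D : Set R3
  t₀ : ℝ
  t_f : ℝ
  k_a : ℝ
  k_c : ℝ
  k_r : ℝ
  l_a : ℝ
  l_c : ℝ
  l_r : ℝ
  κ_p : ℝ
  U : R3 → ℝ
  P : ℝ → ℝ

/-- The standing assumptions on domain, constants, `U` and `P`. -/
structure System.Admissible (M : System) : Prop where
  isOpen_D : IsOpen M.D
  isBounded_D : Bornology.IsBounded M.D
  time_lt : M.t₀ < M.t_f
  k_a_pos : 0 < M.k_a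
  k_r_pos : 0 < M.k_r
  k_c_neg : M.k_c < 0
  l_a_ne : M.l_a ≠ 0
  l_c_ne : M.l_c ≠ 0
  l_r_ne : M.l_r ≠ 0
  κ_p_pos : 0 < M.κ_p
  U_lip : ∃ K, LipschitzOnWith K M.U (closure M.D)
  P_smooth : ContDiff ℝ 2 M.P
  P_lip : ∃ K, LipschitzWith K M.P
  P_mono : ∀ s, 0 ≤ s → 0 ≤ deriv M.P s
  propulsion_lip : ∃ K, LipschitzWith K fun v : R3 => (M.κ_p * (1 - M.P ‖v‖)) • v

/-- The Yukawa kernel, i.e. the decaying fundamental solution of `(4πk)⁻¹ (l² - Δ)` on `ℝ³`. -/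
def yukawa (k l : ℝ) (z : R3) : ℝ := k * Real.exp (-(|l| * ‖z‖)) / ‖z‖

/-- The potential of the density `f`, extended by zero outside `D`. -/
def potential {F : Type*} [NormedAddCommGroup F] [NormedSpace ℝ F]
    (D : Set R3) (k l : ℝ) (f : R3 → F) (x : R3) : F :=
  ∫ y in D, yukawa k l (x - y) • f y

namespace System

variable (M : System)

/-- Alignment potential, `π_ρ` (on scalar fields) and `π_j` (on vector fields). -/
def alignPot {F : Type*} [NormedAddCommGroup F] [NormedSpace ℝ F] (f : R3 → F) : R3 → F :=
  potential M.D M.k_a M.l_a f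

/-- Cohesion potential `v_c`. -/
def cohPot (r : R3 → ℝ) : R3 → ℝ := potential M.D M.k_c M.l_c r

/-- Repulsion potential `v_r`. -/
def repPot (r : R3 → ℝ) : R3 → ℝ := potential M.D M.k_r M.l_r r

/-- The source
`S[ρ, j] = ρ π_j[j] - j π_ρ[ρ] - ρ ∇(v_c[ρ] + v_r[ρ] + U) + κ_p j (1 - P(ρ⁻¹ ‖j‖))`
at a fixed time. -/
def source (r : R3 → ℝ) (q : R3 → R3) (x : R3) : R3 :=
  r x • M.alignPot q x - M.alignPot r x • q x
    - r x • (gradient (M.cohPot r) x + gradient (M.repPot r) x + gradient M.U x)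
    + (M.κ_p * (1 - M.P ((r x)⁻¹ * ‖q x‖))) • q x

/-- Weak continuity equation. The test functions are smooth up to the boundary of `D`, so that the
identity contains the boundary condition `j · ν = 0` on `∂D`. -/
def WeakContinuity (ρ : ℝ → R3 → ℝ) (j : ℝ → R3 → R3) : Prop :=
  ∀ φ : ℝ → R3 → ℝ, ContDiff ℝ ∞ (Function.uncurry φ) →
    (∫ x in M.D, ρ M.t_f x * φ M.t_f x) - (∫ x in M.D, ρ M.t₀ x * φ M.t₀ x) =
      ∫ t in M.t₀..M.t_f, ∫ x in M.D,
        (ρ t x * deriv (fun s => φ s x) t + ⟪j t x, gradient (φ t) x⟫)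

/-- Weak momentum equation, again with test fields smooth up to the boundary of `D`. The term
`ρ⁻¹ ⟪j, (Dψ) j⟫` is the matrix inner product of `ρ⁻¹ j jᵀ` and `∇ψ`. -/
def WeakMomentum (ρ : ℝ → R3 → ℝ) (j : ℝ → R3 → R3) : Prop :=
  ∀ ψ : ℝ → R3 → R3, ContDiff ℝ ∞ (Function.uncurry ψ) →
    (∫ x in M.D, ⟪j M.t_f x, ψ M.t_f x⟫) - (∫ x in M.D, ⟪j M.t₀ x, ψ M.t₀ x⟫) =
      ∫ t in M.t₀..M.t_f, ∫ x in M.D,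
        (⟪j t x, deriv (fun s => ψ s x) t⟫
          + (ρ t x)⁻¹ * ⟪j t x, fderiv ℝ (ψ t) x (j t x)⟫
          + ⟪ψ t x, M.source (ρ t) (j t) x⟫)

/-- `(1/2) ∫_D ρ⁻¹ jᵀj + ρ v_r[ρ] + ρ v_c[ρ] dx` at a fixed time. -/
def energy (r : R3 → ℝ) (q : R3 → R3) : ℝ :=
  (1 / 2) * ∫ x in M.D, ((r x)⁻¹ * ‖q x‖ ^ 2 + r x * M.repPot r x + r x * M.cohPot r x)

/-- The power supplied by alignment, confinement and self-propulsion at a fixed time. -/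
def power (r : R3 → ℝ) (q : R3 → R3) : ℝ :=
  ∫ x in M.D, (⟪q x, M.alignPot q x⟫ - (r x)⁻¹ * ‖q x‖ ^ 2 * M.alignPot r x
    - ⟪q x, gradient M.U x⟫
    + M.κ_p * ((r x)⁻¹ * ‖q x‖ ^ 2) * (1 - M.P ‖(r x)⁻¹ • q x‖))

/-- The relaxed energy balance, for a.e. `τ ∈ [t₀, t_f]`. -/
def EnergyInequality (ρ : ℝ → R3 → ℝ) (j : ℝ → R3 → R3) : Prop :=
  ∀ᵐ τ ∂(volume.restrict (Icc M.t₀ M.t_f)),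
    M.energy (ρ τ) (j τ) - M.energy (ρ M.t₀) (j M.t₀) ≤
      ∫ t in M.t₀..τ, M.power (ρ t) (j t)

/-- The density class `C³([t₀, t_f]; H²(D)) ∩ Lip([t₀, t_f] × cl D)`, `ρ > 0`. -/
structure IsDensity (ρ : ℝ → R3 → ℝ) : Prop where
  c3H2 : IsC3H2 M.D M.t₀ M.t_f ρ
  lip : IsLipSpaceTime M.D M.t₀ M.t_f ρ
  pos : ∀ t ∈ Icc M.t₀ M.t_f, ∀ x ∈ closure M.D, 0 < ρ t x

/-- The momentum class `C_w([t₀, t_f]; L²(D; ℝ³)) ∩ L^∞((t₀, t_f) × D; ℝ³)`. -/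
structure IsMomentum (j : ℝ → R3 → R3) : Prop where
  memL2 : ∀ t ∈ Icc M.t₀ M.t_f, MemLp (j t) 2 (volume.restrict M.D)
  weak_continuous : ∀ ψ : R3 → R3, MemLp ψ 2 (volume.restrict M.D) →
    ContinuousOn (fun t => ∫ x in M.D, ⟪j t x, ψ x⟫) (Icc M.t₀ M.t_f)
  bounded : MemLp (Function.uncurry j) ⊤ (volume.restrict (Ioo M.t₀ M.t_f ×ˢ M.D))

/-- The assumptions on the initial data. -/
structure IsInitialData (ρ₀ : R3 → ℝ) (j₀ : R3 → R3) : Prop where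
  density_H2 : MemH2 M.D ρ₀
  density_lip : ∃ K, LipschitzOnWith K ρ₀ (closure M.D)
  density_pos : ∀ x ∈ closure M.D, 0 < ρ₀ x
  momentum_lip : ∃ K, LipschitzOnWith K j₀ (closure M.D)

/-- Bounded-energy weak solutions with initial data `(ρ₀, j₀)`. -/
structure IsBoundedEnergyWeakSolution (ρ₀ : R3 → ℝ) (j₀ : R3 → R3)
    (ρ : ℝ → R3 → ℝ) (j : ℝ → R3 → R3) : Prop where
  density : M.IsDensity ρ
  momentum : M.IsMomentum j
  continuity_eq : M.WeakContinuity ρ j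
  momentum_eq : M.WeakMomentum ρ j
  initial_density : ∀ᵐ x ∂(volume.restrict M.D), ρ M.t₀ x = ρ₀ x
  initial_momentum : ∀ᵐ x ∂(volume.restrict M.D), j M.t₀ x = j₀ x
  energy_ineq : M.EnergyInequality ρ j

/-- `i` is a Lipschitz momentum field with `i(t₀) = j₀` for which `(ρ, i)` solves the continuity
equation and the momentum equation almost everywhere in `(t₀, t_f) × D`. The derivatives exist
almost everywhere when `ρ > 0` and `i` are Lipschitz. -/
structure IsLipschitzSolution (j₀ : R3 → R3) (ρ : ℝ → R3 → ℝ) (i : ℝ → R3 → R3) : Prop where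
  lip : IsLipSpaceTime M.D M.t₀ M.t_f i
  initial : ∀ x ∈ M.D, i M.t₀ x = j₀ x
  continuity_eq : ∀ᵐ p ∂((volume : Measure (ℝ × R3)).restrict (Ioo M.t₀ M.t_f ×ˢ M.D)),
    deriv (fun s => ρ s p.2) p.1 + ∑ b, (fderiv ℝ (i p.1) p.2 (basisVec b)) b = 0
  momentum_eq : ∀ᵐ p ∂((volume : Measure (ℝ × R3)).restrict (Ioo M.t₀ M.t_f ×ˢ M.D)),
    deriv (fun s => i s p.2) p.1
      + ∑ b, fderiv ℝ (fun y => ((ρ p.1 y)⁻¹ * i p.1 y b) • i p.1 y) p.2 (basisVec b) =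
    M.source (ρ p.1) (i p.1) p.2

end System

end EulerAlignment

end

/-! The proof is a relative energy argument. Put `v = ρ⁻¹ i` and `w = ρ⁻¹ j`, and measure the
distance between the two momenta by `1/2 ∫ ρ ‖v - w‖²`. Both momenta share the density `ρ`, so the
forces from cohesion, repulsion and `U` cancel in the balance of this quantity.

Expanding the square gives three contributions. The kinetic energy of `j` is controlled by the
energy inequality, the mixed term by the weak momentum equation tested with `v`, and the `‖v‖²` term
by the weak continuity equation tested with `‖v‖²/2`. Two points make this legitimate. The field `v`
is only Lipschitz, so the weak equations are first extended to Lipschitz test functions by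
mollification (`WeakContinuity.lipschitz`, `WeakMomentum.lipschitz`). The energy inequality also
contains potential energy, whose rate of change is identified through the continuity equation and
the symmetry of the kernel (`integral_weight_fderiv_potential`). Test functions need not vanish on
`∂D`, so no boundary terms appear and no regularity of `∂D` is used.

In the resulting `relative_energy_inequality` the alignment difference is bounded by Schur's test,
the damping by `π_ρ[ρ] ≥ 0` has the favourable sign, self-propulsion is Lipschitz in the velocity,
and the transport term is bounded by the Lipschitz constant of `v`. All of this is at most a
constant times the relative energy (`exists_relative_energy_bound`).

The energy inequality is known only for almost every time, so every balance is integrated against a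
decreasing weight `θ(t)` with `θ(t_f) = 0`. An exponential weight (`exists_weight`) then plays the
role of Gronwall's lemma: a nonnegative integrand has nonpositive integral, which forces `v = w`
almost everywhere. -/

noncomputable section

open Filter Topology

namespace EulerAlignment

section Mollification

variable {E F : Type*} [NormedAddCommGroup E] [NormedSpace ℝ E] [FiniteDimensional ℝ E]
  [MeasurableSpace E] [BorelSpace E]
  [NormedAddCommGroup F] [NormedSpace ℝ F] [FiniteDimensional ℝ F]

open ContinuousLinearMap in
/-- The derivative of a mollified Lipschitz function is the mollification of its a.e. derivative. -/
theorem hasFDerivAt_convolution_of_lipschitz (μ : Measure E) [μ.IsAddHaarMeasure]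
    {f : E → F} {K : NNReal} (hf : LipschitzWith K f) {η : E → ℝ} (hη : Continuous η)
    (hη' : HasCompactSupport η) (x : E) :
    HasFDerivAt (convolution η f (lsmul ℝ ℝ) μ)
      (convolution η (fderiv ℝ f) (lsmul ℝ ℝ) μ x) x := by
  have hint : Integrable η μ := hη.integrable_of_hasCompactSupport hη'
  have key := hasFDerivAt_integral_of_dominated_loc_of_lip (𝕜 := ℝ) (μ := μ)
    (F := fun y t => η t • f (y - t)) (F' := fun t => η t • fderiv ℝ f (x - t)) (x₀ := x)
    (bound := fun t => K * |η t|) (s := univ) univ_mem ?_ ?_ ?_ ?_ ?_ ?_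
  · exact key.2
  · refine Eventually.of_forall fun y => ?_
    exact (hη.smul (hf.continuous.comp (by fun_prop))).aestronglyMeasurable
  · refine (hη.smul (hf.continuous.comp (by fun_prop))).integrable_of_hasCompactSupport ?_
    exact hη'.smul_right
  · refine hη.aestronglyMeasurable.smul ?_
    exact ((measurable_fderiv ℝ f).comp (measurable_const.sub measurable_id)).aestronglyMeasurable
  · refine Eventually.of_forall fun t => ?_
    refine LipschitzOnWith.of_dist_le_mul fun y _ z _ => ?_
    have h := hf.dist_le_mul (y - t) (z - t)
    rw [dist_sub_right] at h
    simp only [dist_smul₀, Real.norm_eq_abs, Real.coe_nnabs, abs_mul, abs_abs, NNReal.abs_eq]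
    calc |η t| * dist (f (y - t)) (f (z - t)) ≤ |η t| * (K * dist y z) := by gcongr
      _ = _ := by ring
  · exact hint.abs.const_mul _
  -- Rademacher's theorem, transported by the reflection `t ↦ x - t`. Only almost every `t` matters,
  -- so the mollification is differentiable at every `x`.
  · have h := (Measure.measurePreserving_sub_left μ x).quasiMeasurePreserving.ae
      (hf.ae_differentiableAt (μ := μ))
    filter_upwards [h] with t ht
    exact ((ht.hasFDerivAt.comp x ((hasFDerivAt_id x).sub_const t)).const_smul (η t))

open ContinuousLinearMap in
/-- Lipschitz functions are approximated by smooth functions, with convergence of derivatives. -/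
theorem exists_smooth_approx (μ : Measure E) [μ.IsAddHaarMeasure]
    {f : E → F} {K : NNReal} (hf : LipschitzWith K f) :
    ∃ g : ℕ → E → F, (∀ n, ContDiff ℝ ∞ (g n)) ∧
      (∀ n x, ‖g n x - f x‖ ≤ K * (1 / ((n : ℝ) + 1))) ∧
      (∀ n x, ‖fderiv ℝ (g n) x‖ ≤ K) ∧
      ∀ᵐ x ∂μ, Tendsto (fun n => fderiv ℝ (g n) x) atTop (𝓝 (fderiv ℝ f x)) := by
  -- The radii keep the fixed ratio 2, as the Lebesgue differentiation argument for the derivatives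
  -- requires (`K := 2` below).
  let φ : ℕ → ContDiffBump (0 : E) := fun n =>
    { rIn := (1 / ((n : ℝ) + 1)) / 2
      rOut := 1 / ((n : ℝ) + 1)
      rIn_pos := by positivity
      rIn_lt_rOut := by
        have : (0 : ℝ) < 1 / ((n : ℝ) + 1) := by positivity
        linarith }
  have hd : ∀ n x, HasFDerivAt (convolution ((φ n).normed μ) f (lsmul ℝ ℝ) μ)
      (convolution ((φ n).normed μ) (fderiv ℝ f) (lsmul ℝ ℝ) μ x) x := fun n x =>
    hasFDerivAt_convolution_of_lipschitz μ hf ((φ n).continuous_normed)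
      ((φ n).hasCompactSupport_normed) x
  refine ⟨fun n => convolution ((φ n).normed μ) f (lsmul ℝ ℝ) μ, fun n => ?_, fun n x => ?_,
    fun n x => ?_, ?_⟩
  · exact HasCompactSupport.contDiff_convolution_left _ (φ n).hasCompactSupport_normed
      (φ n).contDiff_normed hf.continuous.locallyIntegrable
  · rw [← dist_eq_norm]
    refine (φ n).dist_normed_convolution_le hf.continuous.aestronglyMeasurable fun y hy => ?_
    refine (hf.dist_le_mul _ _).trans ?_
    gcongr
    exact (Metric.mem_ball.1 hy).le
  · rw [(hd n x).fderiv]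
    calc ‖∫ t, (φ n).normed μ t • fderiv ℝ f (x - t) ∂μ‖
        ≤ ∫ t, (φ n).normed μ t * K ∂μ := by
          refine norm_integral_le_of_norm_le ((φ n).integrable_normed.mul_const _)
            (Eventually.of_forall fun t => ?_)
          rw [norm_smul, Real.norm_of_nonneg ((φ n).nonneg_normed t)]
          exact mul_le_mul_of_nonneg_left (norm_fderiv_le_of_lipschitz ℝ hf)
            ((φ n).nonneg_normed t)
      _ = K := by rw [integral_mul_const, (φ n).integral_normed, one_mul]
  · have hloc : LocallyIntegrable (fderiv ℝ f) μ := by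
      have hb : MemLp (fderiv ℝ f) ⊤ μ :=
        memLp_top_of_bound (measurable_fderiv ℝ f).aestronglyMeasurable K
          (Eventually.of_forall fun x => norm_fderiv_le_of_lipschitz ℝ hf)
      exact hb.locallyIntegrable le_top
    have h := ContDiffBump.ae_convolution_tendsto_right_of_locallyIntegrable (μ := μ) (φ := φ)
      (l := atTop) (K := 2) (g := fderiv ℝ f) tendsto_one_div_add_atTop_nhds_zero_nat
      (Eventually.of_forall fun n => by simp only [φ]; linarith) hloc
    filter_upwards [h] with x hx
    simpa only [(hd _ x).fderiv] using hx

end Mollification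

/-! ### Essentially bounded functions -/

section EssBounded

variable {X : Type*} [MeasurableSpace X] {μ : Measure X}
  {E F G : Type*} [NormedAddCommGroup E] [NormedAddCommGroup F] [NormedAddCommGroup G]

/-- `f` is measurable and bounded almost everywhere. -/
structure EssBounded (μ : Measure X) (f : X → E) : Prop where
  meas : AEStronglyMeasurable f μ
  bound : ∃ C : ℝ, ∀ᵐ x ∂μ, ‖f x‖ ≤ C

theorem EssBounded.of_memLp_top {f : X → E} (hf : MemLp f ⊤ μ) : EssBounded μ f := by
  refine ⟨hf.1, (eLpNormEssSup f μ).toReal, ?_⟩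
  have hfin : eLpNormEssSup f μ ≠ ⊤ := by
    have := hf.2
    rw [eLpNorm_exponent_top] at this
    exact this.ne
  filter_upwards [ae_le_eLpNormEssSup (f := f) (μ := μ)] with x hx
  have := ENNReal.toReal_mono hfin hx
  simpa using this

theorem EssBounded.const [IsFiniteMeasure μ] (c : E) : EssBounded μ fun _ : X => c :=
  ⟨aestronglyMeasurable_const, ‖c‖, Eventually.of_forall fun _ => le_rfl⟩

theorem EssBounded.integrable [IsFiniteMeasure μ] {f : X → E} (hf : EssBounded μ f) :
    Integrable f μ := by
  obtain ⟨C, hC⟩ := hf.bound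
  exact Integrable.of_bound hf.meas C hC

theorem EssBounded.congr {f g : X → E} (hf : EssBounded μ f) (h : f =ᵐ[μ] g) :
    EssBounded μ g := by
  obtain ⟨C, hC⟩ := hf.bound
  refine ⟨hf.meas.congr h, C, ?_⟩
  filter_upwards [hC, h] with x hx hx'
  rwa [← hx']

theorem EssBounded.prodMk {f : X → E} {g : X → F} (hf : EssBounded μ f) (hg : EssBounded μ g) :
    EssBounded μ fun x => (f x, g x) := by
  obtain ⟨C, hC⟩ := hf.bound
  obtain ⟨C', hC'⟩ := hg.bound
  refine ⟨hf.meas.prodMk hg.meas, max C C', ?_⟩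
  filter_upwards [hC, hC'] with x hx hx'
  exact max_le_max hx hx'

theorem EssBounded.comp [ProperSpace E] {g : E → F} (hg : Continuous g) {f : X → E}
    (hf : EssBounded μ f) : EssBounded μ fun x => g (f x) := by
  obtain ⟨C, hC⟩ := hf.bound
  refine ⟨hg.comp_aestronglyMeasurable hf.meas, ?_⟩
  obtain ⟨C', hC'⟩ := (isCompact_closedBall (0 : E) C).exists_bound_of_continuousOn hg.continuousOn
  refine ⟨C', ?_⟩
  filter_upwards [hC] with x hx
  exact hC' _ (by simpa using hx)

theorem EssBounded.comp₂ [ProperSpace E] [ProperSpace F] {g : E → F → G}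
    (hg : Continuous fun q : E × F => g q.1 q.2) {f : X → E} {f' : X → F}
    (hf : EssBounded μ f) (hf' : EssBounded μ f') : EssBounded μ fun x => g (f x) (f' x) :=
  (hf.prodMk hf').comp hg

theorem EssBounded.add {f g : X → E} (hf : EssBounded μ f) (hg : EssBounded μ g) :
    EssBounded μ fun x => f x + g x := by
  obtain ⟨C, hC⟩ := hf.bound
  obtain ⟨C', hC'⟩ := hg.bound
  refine ⟨hf.meas.add hg.meas, C + C', ?_⟩
  filter_upwards [hC, hC'] with x hx hx'
  exact (norm_add_le _ _).trans (add_le_add hx hx')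

theorem EssBounded.neg {f : X → E} (hf : EssBounded μ f) : EssBounded μ fun x => -f x := by
  obtain ⟨C, hC⟩ := hf.bound
  refine ⟨hf.meas.neg, C, ?_⟩
  simpa using hC

theorem EssBounded.sub {f g : X → E} (hf : EssBounded μ f) (hg : EssBounded μ g) :
    EssBounded μ fun x => f x - g x := by
  simpa only [sub_eq_add_neg] using hf.add hg.neg

theorem EssBounded.mul {f g : X → ℝ} (hf : EssBounded μ f) (hg : EssBounded μ g) :
    EssBounded μ fun x => f x * g x :=
  hf.comp₂ (g := fun a b : ℝ => a * b) (by fun_prop) hg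

theorem EssBounded.smul [NormedSpace ℝ E] [ProperSpace E] {f : X → ℝ} {g : X → E}
    (hf : EssBounded μ f) (hg : EssBounded μ g) : EssBounded μ fun x => f x • g x :=
  hf.comp₂ (g := fun (a : ℝ) (b : E) => a • b) (by fun_prop) hg

theorem EssBounded.inner [InnerProductSpace ℝ E] [ProperSpace E] {f g : X → E}
    (hf : EssBounded μ f) (hg : EssBounded μ g) : EssBounded μ fun x => ⟪f x, g x⟫ :=
  hf.comp₂ (g := fun (a : E) (b : E) => ⟪a, b⟫) (by fun_prop) hg

theorem EssBounded.norm {f : X → E} (hf : EssBounded μ f) : EssBounded μ fun x => ‖f x‖ := by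
  obtain ⟨C, hC⟩ := hf.bound
  exact ⟨hf.meas.norm, C, by simpa using hC⟩

theorem EssBounded.clm_apply [NormedSpace ℝ E] [NormedSpace ℝ F] [FiniteDimensional ℝ E]
    [FiniteDimensional ℝ F] {A : X → E →L[ℝ] F} {f : X → E} (hA : EssBounded μ A)
    (hf : EssBounded μ f) : EssBounded μ fun x => A x (f x) := by
  obtain ⟨C, hC⟩ := hA.bound
  obtain ⟨C', hC'⟩ := hf.bound
  refine ⟨(isBoundedBilinearMap_apply (𝕜 := ℝ)).continuous.comp_aestronglyMeasurable
    (hA.meas.prodMk hf.meas), C * C', ?_⟩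
  filter_upwards [hC, hC'] with x hx hx'
  exact (A x).le_of_opNorm_le_of_le hx hx'

end EssBounded

/-! ### The space-time domain -/

namespace System

variable (M : System) {E F G : Type*} [NormedAddCommGroup E] [NormedAddCommGroup F]
  [NormedAddCommGroup G]

/-- The closed space-time domain. -/
def slab : Set (ℝ × R3) := Icc M.t₀ M.t_f ×ˢ closure M.D

/-- Lebesgue measure on the open time interval. -/
abbrev tm : Measure ℝ := volume.restrict (Ioo M.t₀ M.t_f)

/-- Lebesgue measure on the spatial domain. -/
abbrev xm : Measure R3 := volume.restrict M.D

/-- Lebesgue measure on the open space-time domain. -/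
def qm : Measure (ℝ × R3) := volume.restrict (Ioo M.t₀ M.t_f ×ˢ M.D)

theorem qm_eq_prod : M.qm = M.tm.prod M.xm := by
  rw [qm, Measure.prod_restrict]; rfl

/-- `f` is Lipschitz on the closed space-time domain. -/
def LipSlab (f : ℝ × R3 → E) : Prop := ∃ K, LipschitzOnWith K f M.slab

variable {M}

namespace Admissible

variable (hM : M.Admissible)
include hM

theorem isFiniteMeasure_xm : IsFiniteMeasure M.xm :=
  isFiniteMeasure_restrict.2 hM.isBounded_D.measure_lt_top.ne

theorem isFiniteMeasure_qm : IsFiniteMeasure M.qm := by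
  have := hM.isFiniteMeasure_xm
  rw [qm_eq_prod]; infer_instance

theorem isCompact_slab : IsCompact M.slab :=
  isCompact_Icc.prod hM.isBounded_D.isCompact_closure

theorem ae_mem : ∀ᵐ p ∂M.qm, p.1 ∈ Ioo M.t₀ M.t_f ∧ p.2 ∈ M.D := by
  have := ae_restrict_mem (μ := (volume : Measure (ℝ × R3)))
    (measurableSet_Ioo.prod hM.isOpen_D.measurableSet : MeasurableSet (Ioo M.t₀ M.t_f ×ˢ M.D))
  filter_upwards [this] with p hp using hp

theorem slab_mem_nhds {p : ℝ × R3} (h : p.1 ∈ Ioo M.t₀ M.t_f ∧ p.2 ∈ M.D) : M.slab ∈ 𝓝 p :=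
  prod_mem_nhds (Icc_mem_nhds h.1.1 h.1.2)
    (mem_of_superset (hM.isOpen_D.mem_nhds h.2) subset_closure)

theorem eventuallyEq_of_eqOn {X : Type*} {f g : ℝ × R3 → X} (h : EqOn f g M.slab) {p : ℝ × R3}
    (hp : p.1 ∈ Ioo M.t₀ M.t_f ∧ p.2 ∈ M.D) : f =ᶠ[𝓝 p] g :=
  h.eventuallyEq_of_mem (hM.slab_mem_nhds hp)

omit hM in
theorem mem_slab {t : ℝ} {x : R3} (ht : t ∈ Icc M.t₀ M.t_f) (hx : x ∈ M.D) : (t, x) ∈ M.slab :=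
  ⟨ht, subset_closure hx⟩

theorem ae_mem_slab {t : ℝ} (ht : t ∈ Icc M.t₀ M.t_f) : ∀ᵐ x ∂M.xm, (t, x) ∈ M.slab := by
  filter_upwards [ae_restrict_mem hM.isOpen_D.measurableSet] with x hx using mem_slab ht hx

theorem integral_qm [NormedSpace ℝ E] {f : ℝ × R3 → E} (hf : Integrable f M.qm) :
    ∫ p, f p ∂M.qm = ∫ t in M.t₀..M.t_f, ∫ x in M.D, f (t, x) := by
  rw [intervalIntegral.integral_of_le hM.time_lt.le, integral_Ioc_eq_integral_Ioo]
  rw [qm_eq_prod] at hf ⊢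
  have := hM.isFiniteMeasure_xm
  exact integral_prod f hf

theorem ae_ae {P : ℝ × R3 → Prop} (h : ∀ᵐ p ∂M.qm, P p) :
    ∀ᵐ t ∂M.tm, ∀ᵐ x ∂M.xm, P (t, x) := by
  have := hM.isFiniteMeasure_xm
  rw [qm_eq_prod] at h
  exact Measure.ae_ae_of_ae_prod h

end Admissible

/-! ### Lipschitz functions on the closed space-time domain -/

namespace LipSlab

theorem continuousOn {f : ℝ × R3 → E} (hf : M.LipSlab f) : ContinuousOn f M.slab :=
  hf.choose_spec.continuousOn

theorem bound (hM : M.Admissible) {f : ℝ × R3 → E} (hf : M.LipSlab f) :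
    ∃ C, ∀ p ∈ M.slab, ‖f p‖ ≤ C :=
  hM.isCompact_slab.exists_bound_of_continuousOn hf.continuousOn

theorem fst : M.LipSlab Prod.fst := ⟨1, LipschitzWith.prod_fst.lipschitzOnWith⟩

theorem prodMk {f : ℝ × R3 → E} {g : ℝ × R3 → F} (hf : M.LipSlab f) (hg : M.LipSlab g) :
    M.LipSlab fun p => (f p, g p) := by
  obtain ⟨K, hK⟩ := hf
  obtain ⟨K', hK'⟩ := hg
  exact ⟨_, hK.prodMk hK'⟩

variable [NormedSpace ℝ E] [NormedSpace ℝ F] [NormedSpace ℝ G]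

/-- A `C¹` map is locally Lipschitz, hence Lipschitz on the compact image of the slab, which need
not be convex. This makes products and `ρ⁻¹` Lipschitz. -/
theorem comp_contDiffAt (hM : M.Admissible) {f : ℝ × R3 → E} (hf : M.LipSlab f) {g : E → F}
    (hg : ∀ p ∈ M.slab, ContDiffAt ℝ 1 g (f p)) : M.LipSlab fun p => g (f p) := by
  have hc : IsCompact (f '' M.slab) := hM.isCompact_slab.image_of_continuousOn hf.continuousOn
  have hl : LocallyLipschitzOn (f '' M.slab) g := by
    rintro _ ⟨p, hp, rfl⟩
    obtain ⟨K, t, ht, hK⟩ := (hg p hp).exists_lipschitzOnWith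
    exact ⟨K, t, mem_nhdsWithin_of_mem_nhds ht, hK⟩
  obtain ⟨K', hK'⟩ := hl.exists_lipschitzOnWith_of_compact hc
  obtain ⟨K, hK⟩ := hf
  exact ⟨K' * K, hK'.comp hK (mapsTo_image _ _)⟩

theorem comp (hM : M.Admissible) {f : ℝ × R3 → E} (hf : M.LipSlab f) {g : E → F}
    (hg : ContDiff ℝ 1 g) : M.LipSlab fun p => g (f p) :=
  hf.comp_contDiffAt hM fun _ _ => hg.contDiffAt

theorem comp₂ (hM : M.Admissible) {f : ℝ × R3 → E} {f' : ℝ × R3 → F} (hf : M.LipSlab f)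
    (hf' : M.LipSlab f') {g : E → F → G} (hg : ContDiff ℝ 1 fun q : E × F => g q.1 q.2) :
    M.LipSlab fun p => g (f p) (f' p) :=
  (hf.prodMk hf').comp hM hg

theorem smul (hM : M.Admissible) {f : ℝ × R3 → ℝ} {g : ℝ × R3 → E} (hf : M.LipSlab f)
    (hg : M.LipSlab g) : M.LipSlab fun p => f p • g p :=
  hf.comp₂ hM hg (g := fun (a : ℝ) (b : E) => a • b) (by fun_prop)

theorem mul (hM : M.Admissible) {f g : ℝ × R3 → ℝ} (hf : M.LipSlab f)
    (hg : M.LipSlab g) : M.LipSlab fun p => f p * g p :=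
  hf.comp₂ hM hg (g := fun (a : ℝ) (b : ℝ) => a * b) (by fun_prop)

variable [FiniteDimensional ℝ E]

/-- Gives access to Rademacher's theorem and to mollification on the whole space. The slab is a
neighbourhood of each interior point, so derivatives there do not depend on the extension. -/
theorem exists_extension {f : ℝ × R3 → E} (hf : M.LipSlab f) :
    ∃ (g : ℝ × R3 → E) (K : NNReal), LipschitzWith K g ∧ EqOn f g M.slab := by
  obtain ⟨K, hK⟩ := hf
  obtain ⟨g, hg, h⟩ := hK.extend_finite_dimension
  exact ⟨g, _, hg, h⟩

instance : (volume : Measure (ℝ × R3)).IsAddHaarMeasure :=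
  inferInstanceAs (((volume : Measure ℝ).prod (volume : Measure R3)).IsAddHaarMeasure)

theorem ae_differentiableAt (hM : M.Admissible) {f : ℝ × R3 → E} (hf : M.LipSlab f) :
    ∀ᵐ p ∂M.qm, DifferentiableAt ℝ f p := by
  obtain ⟨g, K, hg, h⟩ := hf.exists_extension
  have := ae_restrict_of_ae (s := Ioo M.t₀ M.t_f ×ˢ M.D)
    (hg.ae_differentiableAt (μ := (volume : Measure (ℝ × R3))))
  filter_upwards [this, hM.ae_mem] with p hp hp'
  exact (hM.eventuallyEq_of_eqOn h hp').differentiableAt_iff.2 hp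

theorem essBounded (hM : M.Admissible) {f : ℝ × R3 → E} (hf : M.LipSlab f) :
    EssBounded M.qm f := by
  obtain ⟨g, K, hg, h⟩ := hf.exists_extension
  obtain ⟨C, hC⟩ := hf.bound hM
  refine ⟨hg.continuous.aestronglyMeasurable.congr ?_, C, ?_⟩
  · filter_upwards [hM.ae_mem] with p hp using (h (mem_of_mem_nhds (hM.slab_mem_nhds hp))).symm
  · filter_upwards [hM.ae_mem] with p hp using hC p (mem_of_mem_nhds (hM.slab_mem_nhds hp))

theorem essBounded_slice (hM : M.Admissible) {f : ℝ × R3 → E} (hf : M.LipSlab f) {t : ℝ}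
    (ht : t ∈ Icc M.t₀ M.t_f) : EssBounded M.xm fun x => f (t, x) := by
  obtain ⟨g, K, hg, h⟩ := hf.exists_extension
  obtain ⟨C, hC⟩ := hf.bound hM
  refine ⟨(hg.continuous.comp (Continuous.prodMk_right t)).aestronglyMeasurable.congr ?_, C, ?_⟩
  · filter_upwards [hM.ae_mem_slab ht] with x hx using (h hx).symm
  · filter_upwards [hM.ae_mem_slab ht] with x hx using hC _ hx

theorem essBounded_fderiv (hM : M.Admissible) {f : ℝ × R3 → E} (hf : M.LipSlab f) :
    EssBounded M.qm (fderiv ℝ f) := by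
  obtain ⟨g, K, hg, h⟩ := hf.exists_extension
  have he : fderiv ℝ g =ᵐ[M.qm] fderiv ℝ f := by
    filter_upwards [hM.ae_mem] with p hp using (hM.eventuallyEq_of_eqOn h hp).fderiv_eq.symm
  exact EssBounded.congr ⟨(measurable_fderiv ℝ g).aestronglyMeasurable, K,
    Eventually.of_forall fun p => norm_fderiv_le_of_lipschitz ℝ hg⟩ he

end LipSlab

end System

/-! ### Slices of differentiable functions -/

section Slices

variable {F : Type*} [NormedAddCommGroup F] [NormedSpace ℝ F] {f : ℝ → R3 → F} {p : ℝ × R3}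

theorem hasDerivAt_slice (h : DifferentiableAt ℝ (Function.uncurry f) p) :
    HasDerivAt (fun s => f s p.2) (fderiv ℝ (Function.uncurry f) p (1, 0)) p.1 :=
  h.hasFDerivAt.comp_hasDerivAt (f := fun s => (s, p.2)) p.1
    ((hasDerivAt_id p.1).prodMk (hasDerivAt_const p.1 p.2))

theorem hasFDerivAt_slice (h : DifferentiableAt ℝ (Function.uncurry f) p) :
    HasFDerivAt (f p.1) ((fderiv ℝ (Function.uncurry f) p).comp
      (ContinuousLinearMap.inr ℝ ℝ R3)) p.2 :=
  h.hasFDerivAt.comp (f := fun x => (p.1, x)) p.2 (hasFDerivAt_prodMk_right p.1 p.2)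

theorem inner_gradient_slice {f : ℝ → R3 → ℝ} (h : DifferentiableAt ℝ (Function.uncurry f) p)
    (q : R3) : ⟪q, gradient (f p.1) p.2⟫ = fderiv ℝ (Function.uncurry f) p (0, q) := by
  rw [inner_gradient_right, (hasFDerivAt_slice h).fderiv]
  rfl

theorem apply_time_space (A : ℝ × R3 →L[ℝ] F) (a : ℝ) (q : R3) :
    A (a, q) = a • A (1, 0) + A (0, q) := by
  rw [← map_smul, ← map_add]; simp

end Slices

namespace System

variable {M : System}

theorem tendsto_clm_apply {E F : Type*} [NormedAddCommGroup E]
    [NormedSpace ℝ E] [NormedAddCommGroup F] [NormedSpace ℝ F] {A : ℕ → E →L[ℝ] F}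
    {B : E →L[ℝ] F} (h : Tendsto A atTop (𝓝 B)) (x : E) :
    Tendsto (fun n => A n x) atTop (𝓝 (B x)) :=
  ((ContinuousLinearMap.apply ℝ F x).continuous.tendsto B).comp h

/-! ### Weak equations with Lipschitz test functions -/

section Approximation

variable {F : Type*} [NormedAddCommGroup F] [NormedSpace ℝ F] [FiniteDimensional ℝ F]

/-- A Lipschitz function on the closed space-time domain is the limit of smooth functions. -/
theorem LipSlab.exists_smooth_approx (hM : M.Admissible) {f : ℝ × R3 → F} (hf : M.LipSlab f) :
    ∃ (g : ℕ → ℝ × R3 → F) (C : ℝ), (∀ n, ContDiff ℝ ∞ (g n)) ∧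
      (∀ n, ∀ p ∈ M.slab, ‖g n p‖ ≤ C) ∧ (∀ n p, ‖fderiv ℝ (g n) p‖ ≤ C) ∧
      (∀ p ∈ M.slab, Tendsto (fun n => g n p) atTop (𝓝 (f p))) ∧
      ∀ᵐ p ∂M.qm, Tendsto (fun n => fderiv ℝ (g n) p) atTop (𝓝 (fderiv ℝ f p)) := by
  obtain ⟨h, K, hh, hfh⟩ := hf.exists_extension
  obtain ⟨C, hC⟩ := hf.bound hM
  obtain ⟨g, hg, hgb, hgd, hgt⟩ :=
    EulerAlignment.exists_smooth_approx (volume : Measure (ℝ × R3)) hh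
  refine ⟨g, K + max C 0, hg, fun n p hp => ?_, fun n p => ?_, fun p hp => ?_, ?_⟩
  · have h1 := hgb n p
    have h2 := hC p hp
    have h3 : (K : ℝ) * (1 / ((n : ℝ) + 1)) ≤ K := by
      refine mul_le_of_le_one_right K.coe_nonneg ?_
      rw [div_le_one (by positivity)]
      linarith [n.cast_nonneg (α := ℝ)]
    rw [← hfh hp] at h1
    calc ‖g n p‖ = ‖(g n p - f p) + f p‖ := by rw [sub_add_cancel]
      _ ≤ ‖g n p - f p‖ + ‖f p‖ := norm_add_le _ _
      _ ≤ K + max C 0 := add_le_add (h1.trans h3) (h2.trans (le_max_left _ _))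
  · exact (hgd n p).trans (le_add_of_nonneg_right (le_max_right _ _))
  · rw [hfh hp, tendsto_iff_norm_sub_tendsto_zero]
    refine squeeze_zero (fun n => norm_nonneg _) (fun n => hgb n p) ?_
    simpa using (tendsto_one_div_add_atTop_nhds_zero_nat (𝕜 := ℝ)).const_mul (K : ℝ)
  · filter_upwards [ae_restrict_of_ae (s := Ioo M.t₀ M.t_f ×ˢ M.D) hgt, hM.ae_mem] with p hp hp'
    rwa [(hM.eventuallyEq_of_eqOn hfh hp').fderiv_eq]

end Approximation

variable {ρ : ℝ → R3 → ℝ} {j : ℝ → R3 → R3}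

theorem IsDensity.lipSlab (hρ : M.IsDensity ρ) : M.LipSlab fun p => ρ p.1 p.2 := hρ.lip

theorem IsDensity.lipSlab_inv (hM : M.Admissible) (hρ : M.IsDensity ρ) :
    M.LipSlab fun p => (ρ p.1 p.2)⁻¹ :=
  hρ.lipSlab.comp_contDiffAt hM fun p hp =>
    contDiffAt_inv ℝ (hρ.pos p.1 hp.1 p.2 hp.2).ne'

theorem IsMomentum.essBounded (hj : M.IsMomentum j) : EssBounded M.qm fun p => j p.1 p.2 :=
  EssBounded.of_memLp_top hj.bounded

/-- The integrand `ρ ∂ₜf + j · ∇f` is the space-time derivative of `f` in the direction `(ρ, j)`.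
Mollifications pass to the limit by dominated convergence: derivatives converge almost everywhere,
and values converge everywhere on the slab, which is needed on the two null slices `t₀` and `t_f`.
-/
theorem WeakContinuity.lipschitz (hM : M.Admissible) (hρ : M.IsDensity ρ) (hj : M.IsMomentum j)
    (hw : M.WeakContinuity ρ j) {f : ℝ × R3 → ℝ} (hf : M.LipSlab f) :
    (∫ x in M.D, ρ M.t_f x * f (M.t_f, x)) - (∫ x in M.D, ρ M.t₀ x * f (M.t₀, x)) =
      ∫ p, fderiv ℝ f p (ρ p.1 p.2, j p.1 p.2) ∂M.qm := by
  obtain ⟨g, C, hg, hgb, hgd, hgt, hgdt⟩ := hf.exists_smooth_approx hM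
  have := hM.isFiniteMeasure_xm
  have := hM.isFiniteMeasure_qm
  have hX : EssBounded M.qm fun p => (ρ p.1 p.2, j p.1 p.2) :=
    (hρ.lipSlab.essBounded hM).prodMk hj.essBounded
  have hbd : ∀ t ∈ Icc M.t₀ M.t_f, Tendsto (fun n => ∫ x in M.D, ρ t x * g n (t, x)) atTop
      (𝓝 (∫ x in M.D, ρ t x * f (t, x))) := by
    intro t ht
    have hr := hρ.lipSlab.essBounded_slice hM ht
    refine tendsto_integral_of_dominated_convergence (fun x => ‖ρ t x‖ * C) (fun n => ?_)
      (hr.norm.integrable.mul_const C) (fun n => ?_) ?_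
    · exact hr.meas.mul ((hg n).continuous.comp (Continuous.prodMk_right t)).aestronglyMeasurable
    · filter_upwards [hM.ae_mem_slab ht] with x hx
      rw [norm_mul]
      exact mul_le_mul_of_nonneg_left (hgb n _ hx) (norm_nonneg _)
    · filter_upwards [hM.ae_mem_slab ht] with x hx using (hgt _ hx).const_mul _
  have hint : Tendsto (fun n => ∫ p, fderiv ℝ (g n) p (ρ p.1 p.2, j p.1 p.2) ∂M.qm) atTop
      (𝓝 (∫ p, fderiv ℝ f p (ρ p.1 p.2, j p.1 p.2) ∂M.qm)) := by
    refine tendsto_integral_of_dominated_convergence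
      (fun p => C * ‖(ρ p.1 p.2, j p.1 p.2)‖) (fun n => ?_)
      (hX.norm.integrable.const_mul C) (fun n => ?_) ?_
    · exact (isBoundedBilinearMap_apply (𝕜 := ℝ)).continuous.comp_aestronglyMeasurable
        ((((hg n).continuous_fderiv (by simp)).aestronglyMeasurable).prodMk hX.meas)
    · exact Eventually.of_forall fun p => (fderiv ℝ (g n) p).le_of_opNorm_le (hgd n p) _
    · filter_upwards [hgdt] with p hp
      exact tendsto_clm_apply hp _
  refine tendsto_nhds_unique ((hbd _ (right_mem_Icc.2 hM.time_lt.le)).sub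
    (hbd _ (left_mem_Icc.2 hM.time_lt.le))) (hint.congr fun n => ?_)
  have h := hw (fun t x => g n (t, x)) (hg n)
  refine Eq.trans ?_ h.symm
  have hi : Integrable (fun p => fderiv ℝ (g n) p (ρ p.1 p.2, j p.1 p.2)) M.qm := by
    refine EssBounded.integrable (EssBounded.clm_apply ⟨?_, C, ?_⟩ hX)
    · exact ((hg n).continuous_fderiv (by simp)).aestronglyMeasurable
    · exact Eventually.of_forall (hgd n)
  rw [hM.integral_qm hi]
  congr! 5 with t x
  have hd : DifferentiableAt ℝ (Function.uncurry fun t x => g n (t, x)) (t, x) :=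
    (hg n).differentiable (by simp) _
  rw [apply_time_space, (hasDerivAt_slice hd).deriv, inner_gradient_slice hd]
  rfl

/-- Since `j = ρ w` with `w = ρ⁻¹ j`, the time and flux terms combine into the pairing of `w` with
the derivative of the test field in the direction `(ρ, j)`. The limit is taken as for the continuity
equation; at the end times `j` is only in `L²`, which still dominates. -/
theorem WeakMomentum.lipschitz (hM : M.Admissible) (hρ : M.IsDensity ρ) (hj : M.IsMomentum j)
    (hS : EssBounded M.qm fun p => M.source (ρ p.1) (j p.1) p.2)
    (hw : M.WeakMomentum ρ j) {f : ℝ × R3 → R3} (hf : M.LipSlab f) :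
    (∫ x in M.D, ⟪j M.t_f x, f (M.t_f, x)⟫) - (∫ x in M.D, ⟪j M.t₀ x, f (M.t₀, x)⟫) =
      ∫ p, (⟪(ρ p.1 p.2)⁻¹ • j p.1 p.2, fderiv ℝ f p (ρ p.1 p.2, j p.1 p.2)⟫
        + ⟪f p, M.source (ρ p.1) (j p.1) p.2⟫) ∂M.qm := by
  obtain ⟨g, C, hg, hgb, hgd, hgt, hgdt⟩ := hf.exists_smooth_approx hM
  have := hM.isFiniteMeasure_xm
  have := hM.isFiniteMeasure_qm
  have hX : EssBounded M.qm fun p => (ρ p.1 p.2, j p.1 p.2) :=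
    (hρ.lipSlab.essBounded hM).prodMk hj.essBounded
  have hW : EssBounded M.qm fun p => (ρ p.1 p.2)⁻¹ • j p.1 p.2 :=
    ((hρ.lipSlab_inv hM).essBounded hM).smul hj.essBounded
  have hbd : ∀ t ∈ Icc M.t₀ M.t_f, Tendsto (fun n => ∫ x in M.D, ⟪j t x, g n (t, x)⟫) atTop
      (𝓝 (∫ x in M.D, ⟪j t x, f (t, x)⟫)) := by
    intro t ht
    have hr := hj.memL2 t ht
    refine tendsto_integral_of_dominated_convergence (fun x => ‖j t x‖ * C) (fun n => ?_)
      ((hr.integrable (by norm_num)).norm.mul_const C) (fun n => ?_) ?_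
    · exact hr.1.inner ((hg n).continuous.comp (Continuous.prodMk_right t)).aestronglyMeasurable
    · filter_upwards [hM.ae_mem_slab ht] with x hx
      exact (norm_inner_le_norm _ _).trans
        (mul_le_mul_of_nonneg_left (hgb n _ hx) (norm_nonneg _))
    · filter_upwards [hM.ae_mem_slab ht] with x hx using tendsto_const_nhds.inner (hgt _ hx)
  have hgm : ∀ n, EssBounded M.qm (g n) := fun n =>
    ⟨(hg n).continuous.aestronglyMeasurable, C, by
      filter_upwards [hM.ae_mem] with p hp using hgb n p (mem_of_mem_nhds (hM.slab_mem_nhds hp))⟩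
  have hgdm : ∀ n, EssBounded M.qm (fderiv ℝ (g n)) := fun n =>
    ⟨((hg n).continuous_fderiv (by simp)).aestronglyMeasurable, C, Eventually.of_forall (hgd n)⟩
  have hi : ∀ n, EssBounded M.qm fun p =>
      ⟪(ρ p.1 p.2)⁻¹ • j p.1 p.2, fderiv ℝ (g n) p (ρ p.1 p.2, j p.1 p.2)⟫
        + ⟪g n p, M.source (ρ p.1) (j p.1) p.2⟫ := fun n =>
    (hW.inner ((hgdm n).clm_apply hX)).add ((hgm n).inner hS)
  have hint : Tendsto (fun n => ∫ p, (⟪(ρ p.1 p.2)⁻¹ • j p.1 p.2,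
      fderiv ℝ (g n) p (ρ p.1 p.2, j p.1 p.2)⟫ + ⟪g n p, M.source (ρ p.1) (j p.1) p.2⟫) ∂M.qm)
      atTop (𝓝 (∫ p, (⟪(ρ p.1 p.2)⁻¹ • j p.1 p.2, fderiv ℝ f p (ρ p.1 p.2, j p.1 p.2)⟫
        + ⟪f p, M.source (ρ p.1) (j p.1) p.2⟫) ∂M.qm)) := by
    refine tendsto_integral_of_dominated_convergence
      (fun p => ‖(ρ p.1 p.2)⁻¹ • j p.1 p.2‖ * (C * ‖(ρ p.1 p.2, j p.1 p.2)‖)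
        + C * ‖M.source (ρ p.1) (j p.1) p.2‖) (fun n => (hi n).meas)
      ((hW.norm.mul ((EssBounded.const C).mul hX.norm)).integrable.add
        (hS.norm.integrable.const_mul C)) (fun n => ?_) ?_
    · filter_upwards [hM.ae_mem] with p hp
      refine (norm_add_le _ _).trans (add_le_add ?_ ?_)
      · exact (norm_inner_le_norm _ _).trans (mul_le_mul_of_nonneg_left
          ((fderiv ℝ (g n) p).le_of_opNorm_le (hgd n p) _) (norm_nonneg _))
      · exact (norm_inner_le_norm _ _).trans (mul_le_mul_of_nonneg_right
          (hgb n p (mem_of_mem_nhds (hM.slab_mem_nhds hp))) (norm_nonneg _))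
    · filter_upwards [hgdt, hM.ae_mem] with p hp hp'
      exact (tendsto_const_nhds.inner (tendsto_clm_apply hp _)).add
        ((hgt p (mem_of_mem_nhds (hM.slab_mem_nhds hp'))).inner tendsto_const_nhds)
  refine tendsto_nhds_unique ((hbd _ (right_mem_Icc.2 hM.time_lt.le)).sub
    (hbd _ (left_mem_Icc.2 hM.time_lt.le))) (hint.congr' ?_)
  have hpos : ∀ᵐ p ∂M.qm, 0 < ρ p.1 p.2 := by
    filter_upwards [hM.ae_mem] with p hp
    have := mem_of_mem_nhds (hM.slab_mem_nhds hp)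
    exact hρ.pos p.1 this.1 p.2 this.2
  refine Eventually.of_forall fun n => ?_
  have h := hw (fun t x => g n (t, x)) (hg n)
  refine Eq.trans ?_ h.symm
  have hae : (fun p : ℝ × R3 => ⟪(ρ p.1 p.2)⁻¹ • j p.1 p.2,
      fderiv ℝ (g n) p (ρ p.1 p.2, j p.1 p.2)⟫ + ⟪g n p, M.source (ρ p.1) (j p.1) p.2⟫) =ᵐ[M.qm]
      fun p => ⟪j p.1 p.2, deriv (fun s => g n (s, p.2)) p.1⟫
          + (ρ p.1 p.2)⁻¹ * ⟪j p.1 p.2, fderiv ℝ (fun x => g n (p.1, x)) p.2 (j p.1 p.2)⟫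
          + ⟪g n (p.1, p.2), M.source (ρ p.1) (j p.1) p.2⟫ := by
    filter_upwards [hpos] with p hp
    have hd : DifferentiableAt ℝ (Function.uncurry fun t x => g n (t, x)) p :=
      (hg n).differentiable (by simp) _
    have e1 := (hasDerivAt_slice hd).deriv
    have e2 := (hasFDerivAt_slice hd).fderiv
    rw [e1, e2, apply_time_space]
    simp only [real_inner_smul_left, inner_add_right, real_inner_smul_right]
    rw [mul_inv_cancel_left₀ hp.ne']
    rfl
  beta_reduce
  rw [integral_congr_ae hae, hM.integral_qm ((hi n).congr hae).integrable]

end System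

/-! ### The Yukawa kernel -/

/-- A locally integrable majorant of the Yukawa kernel and of its gradient. -/
def majorant (z : R3) : ℝ := 1 + (‖z‖⁻¹) ^ 2

theorem majorant_nonneg (z : R3) : 0 ≤ majorant z := by unfold majorant; positivity

theorem majorant_sub_comm (x y : R3) : majorant (x - y) = majorant (y - x) := by
  rw [majorant, majorant, norm_sub_rev]

theorem measurable_majorant : Measurable majorant := by unfold majorant; fun_prop

theorem measurable_yukawa (k l : ℝ) : Measurable (yukawa k l) := by unfold yukawa; fun_prop

theorem yukawa_sub_comm (k l : ℝ) (x y : R3) : yukawa k l (x - y) = yukawa k l (y - x) := by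
  rw [yukawa, yukawa, norm_sub_rev]

theorem yukawa_nonneg {k : ℝ} (hk : 0 ≤ k) (l : ℝ) (z : R3) : 0 ≤ yukawa k l z := by
  unfold yukawa; positivity

theorem abs_yukawa_le (k l : ℝ) (z : R3) : |yukawa k l z| ≤ |k| * majorant z := by
  unfold yukawa majorant
  rw [abs_div, abs_mul, abs_norm, Real.abs_exp, div_eq_mul_inv, mul_assoc]
  refine mul_le_mul_of_nonneg_left ?_ (abs_nonneg k)
  have h1 : Real.exp (-(|l| * ‖z‖)) ≤ 1 := Real.exp_le_one_iff.2 (by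
    have : 0 ≤ |l| * ‖z‖ := by positivity
    linarith)
  have h2 : 0 ≤ ‖z‖⁻¹ := by positivity
  nlinarith [mul_le_mul_of_nonneg_right h1 h2, sq_nonneg (‖z‖⁻¹ - 1)]

/-- For `a ≤ b` the difference splits into `e^{-la} (1/a - 1/b)` and `e^{-la} (1 - e^{-l(b-a)}) /
b`, with `1/a - 1/b = (b - a)/(ab)` and `1 - e^{-s} ≤ s`. Comparing radii, rather than integrating a
gradient along a segment of `ℝ³`, avoids segments through the singularity. -/
theorem abs_exp_div_sub_le {l a b : ℝ} (hl : 0 ≤ l) (ha : 0 < a) (hb : 0 < b) :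
    |Real.exp (-(l * a)) / a - Real.exp (-(l * b)) / b| ≤
      |a - b| * ((1 + l) * ((1 + (a⁻¹) ^ 2) + (1 + (b⁻¹) ^ 2))) := by
  wlog hab : a ≤ b generalizing a b
  · have := this hb ha (le_of_not_ge hab)
    rw [abs_sub_comm, abs_sub_comm a b, add_comm (1 + (a⁻¹) ^ 2)]
    exact this
  have hab' : 0 ≤ b - a := sub_nonneg.2 hab
  have hu : 0 < a⁻¹ := inv_pos.2 ha
  have hv : 0 < b⁻¹ := inv_pos.2 hb
  have e1 : Real.exp (-(l * a)) ≤ 1 := Real.exp_le_one_iff.2 (by nlinarith)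
  have e1' : 0 < Real.exp (-(l * a)) := Real.exp_pos _
  have e2 : 1 - l * (b - a) ≤ Real.exp (-(l * (b - a))) := by
    have := Real.add_one_le_exp (-(l * (b - a)))
    linarith
  have e3 : Real.exp (-(l * b)) = Real.exp (-(l * a)) * Real.exp (-(l * (b - a))) := by
    rw [← Real.exp_add]; ring_nf
  have e4 : Real.exp (-(l * (b - a))) ≤ 1 := Real.exp_le_one_iff.2 (by nlinarith)
  set A := Real.exp (-(l * a))
  set B := Real.exp (-(l * (b - a)))
  have hdiff : a⁻¹ - b⁻¹ = (b - a) * (a⁻¹ * b⁻¹) := by field_simp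
  have hdec : A / a - Real.exp (-(l * b)) / b = A * ((b - a) * (a⁻¹ * b⁻¹)) + A * (1 - B) * b⁻¹ := by
    rw [e3, ← hdiff, div_eq_mul_inv, div_eq_mul_inv]; ring
  have h1 : A * ((b - a) * (a⁻¹ * b⁻¹)) ≤ (b - a) * (a⁻¹ * b⁻¹) :=
    mul_le_of_le_one_left (by positivity) e1
  have h2 : A * (1 - B) ≤ l * (b - a) := by nlinarith
  have h3 : A * (1 - B) * b⁻¹ ≤ l * (b - a) * b⁻¹ := mul_le_mul_of_nonneg_right h2 hv.le
  have h4 : 0 ≤ A * (1 - B) * b⁻¹ := by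
    have : 0 ≤ 1 - B := by linarith
    positivity
  rw [hdec, abs_of_nonneg (by positivity), abs_sub_comm, abs_of_nonneg hab']
  refine (add_le_add h1 h3).trans ?_
  have h5 : a⁻¹ * b⁻¹ + l * b⁻¹ ≤ (1 + l) * ((1 + (a⁻¹) ^ 2) + (1 + (b⁻¹) ^ 2)) := by
    have k1 : a⁻¹ * b⁻¹ ≤ (1 + (a⁻¹) ^ 2) + (1 + (b⁻¹) ^ 2) := by
      nlinarith [sq_nonneg (a⁻¹ - b⁻¹)]
    have k2 : b⁻¹ ≤ (1 + (a⁻¹) ^ 2) + (1 + (b⁻¹) ^ 2) := by nlinarith [sq_nonneg (b⁻¹ - 1)]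
    nlinarith [mul_le_mul_of_nonneg_left k2 hl]
  nlinarith [mul_le_mul_of_nonneg_left h5 hab']

theorem abs_yukawa_sub_le (k l : ℝ) {z z' : R3} (hz : z ≠ 0) (hz' : z' ≠ 0) :
    |yukawa k l z - yukawa k l z'| ≤
      |k| * (1 + |l|) * (majorant z + majorant z') * ‖z - z'‖ := by
  have h := abs_exp_div_sub_le (abs_nonneg l) (norm_pos_iff.2 hz) (norm_pos_iff.2 hz')
  have e : yukawa k l z - yukawa k l z' = k * (Real.exp (-(|l| * ‖z‖)) / ‖z‖ -
      Real.exp (-(|l| * ‖z'‖)) / ‖z'‖) := by unfold yukawa; ring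
  rw [e, abs_mul]
  have h3 : 0 ≤ (1 + |l|) * (majorant z + majorant z') := by
    have := majorant_nonneg z
    have := majorant_nonneg z'
    positivity
  calc _ ≤ |k| * (|‖z‖ - ‖z'‖| * ((1 + |l|) * (majorant z + majorant z'))) :=
        mul_le_mul_of_nonneg_left h (abs_nonneg k)
    _ ≤ |k| * (‖z - z'‖ * ((1 + |l|) * (majorant z + majorant z'))) := by
        gcongr
        exact abs_norm_sub_norm_le z z'
    _ = _ := by ring

theorem integrableOn_majorant (R : ℝ) : IntegrableOn majorant (Metric.ball 0 R) := by
  have h2 : IntegrableOn (fun z : R3 => (‖z‖⁻¹) ^ 2) (Metric.ball 0 R) := by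
    refine integrableOn_ball_of_norm_le_rpow (C := 1) (α := 2) (by simp) (by simp; norm_num) ?_
      (by fun_prop)
    refine Eventually.of_forall fun z => ?_
    rw [Real.norm_of_nonneg (by positivity), one_mul, Real.rpow_neg (norm_nonneg _), inv_pow]
    norm_cast
  exact (integrableOn_const measure_ball_lt_top.ne).add h2

namespace System

variable {M : System}

namespace Admissible

/-- Seen from any `x` in the closure, `D` lies in a ball of one fixed radius, so translation
invariance bounds the integral by that of the truncated majorant, uniformly in `x`. -/
theorem exists_majorant_bound (hM : M.Admissible) :
    ∃ C, 0 ≤ C ∧ ∀ x ∈ closure M.D, Integrable (fun y => majorant (x - y)) M.xm ∧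
      ∫ y in M.D, majorant (x - y) ≤ C := by
  set R := Metric.diam (closure M.D) + 1
  set m : R3 → ℝ := (Metric.ball 0 R).indicator majorant
  have hm : Integrable m := (integrable_indicator_iff measurableSet_ball).2 (integrableOn_majorant R)
  have hm0 : ∀ z, 0 ≤ m z := fun z => indicator_nonneg (fun z _ => majorant_nonneg z) z
  refine ⟨∫ z, m z, integral_nonneg hm0, fun x hx => ?_⟩
  have he : (fun y => m (x - y)) =ᵐ[M.xm] fun y => majorant (x - y) := by
    filter_upwards [ae_restrict_mem hM.isOpen_D.measurableSet] with y hy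
    refine indicator_of_mem ?_ _
    rw [mem_ball_zero_iff, ← dist_eq_norm]
    have := Metric.dist_le_diam_of_mem hM.isBounded_D.closure hx (subset_closure hy)
    linarith
  have hi : Integrable (fun y => m (x - y)) := hm.comp_sub_left x
  refine ⟨hi.restrict.congr he, ?_⟩
  rw [← integral_congr_ae he]
  refine (setIntegral_le_integral hi (Eventually.of_forall fun y => hm0 _)).trans ?_
  rw [integral_sub_left_eq_self m volume x]

end Admissible

variable {F : Type*} [NormedAddCommGroup F] [NormedSpace ℝ F]

theorem integrable_yukawa_smul (hM : M.Admissible) (k l : ℝ) {f : R3 → F}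
    (hf : EssBounded M.xm f) {x : R3} (hx : x ∈ closure M.D) :
    Integrable (fun y => yukawa k l (x - y) • f y) M.xm := by
  obtain ⟨C, -, hC⟩ := hM.exists_majorant_bound
  obtain ⟨B, hB⟩ := hf.bound
  have hy : Integrable (fun y => yukawa k l (x - y)) M.xm := by
    refine ((hC x hx).1.const_mul |k|).mono'
      ((measurable_yukawa k l).comp (measurable_const.sub measurable_id)).aestronglyMeasurable ?_
    exact Eventually.of_forall fun y => abs_yukawa_le k l _
  exact hy.smul_bdd B hf.meas hB

theorem exists_potential_bound (hM : M.Admissible) (k l : ℝ) :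
    ∃ C, 0 ≤ C ∧ ∀ (f : R3 → F) (B : ℝ), (∀ᵐ y ∂M.xm, ‖f y‖ ≤ B) → ∀ x ∈ closure M.D,
      ‖potential M.D k l f x‖ ≤ C * B := by
  obtain ⟨C, hC0, hC⟩ := hM.exists_majorant_bound
  refine ⟨|k| * C, by positivity, fun f B hB x hx => ?_⟩
  -- The sign of `B` is known only if `D` is not null; a null open set is empty and then has no
  -- point `x` in its closure.
  rcases eq_zero_or_neZero M.xm with h0 | h0
  · have hD : M.D = ∅ := by
      rw [Measure.restrict_eq_zero] at h0
      exact (hM.isOpen_D.measure_eq_zero_iff volume).1 h0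
    simp [hD] at hx
  have hB0 : 0 ≤ B := by
    obtain ⟨y, hy⟩ := hB.exists
    exact (norm_nonneg _).trans hy
  calc ‖potential M.D k l f x‖ ≤ ∫ y in M.D, |k| * majorant (x - y) * B := by
        refine norm_integral_le_of_norm_le (((hC x hx).1.const_mul _).mul_const _) ?_
        filter_upwards [hB] with y hy
        rw [norm_smul]
        exact mul_le_mul (abs_yukawa_le k l _) hy (norm_nonneg _)
          (mul_nonneg (abs_nonneg _) (majorant_nonneg _))
    _ = |k| * (∫ y in M.D, majorant (x - y)) * B := by
        rw [integral_mul_const, integral_const_mul]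
    _ ≤ |k| * C * B := by
        gcongr
        exact (hC x hx).2

theorem potential_sub (hM : M.Admissible) (k l : ℝ) {f g : R3 → F}
    (hf : EssBounded M.xm f) (hg : EssBounded M.xm g) {x : R3} (hx : x ∈ closure M.D) :
    potential M.D k l (fun y => f y - g y) x = potential M.D k l f x - potential M.D k l g x := by
  unfold potential
  rw [← integral_sub (integrable_yukawa_smul hM k l hf hx) (integrable_yukawa_smul hM k l hg hx)]
  simp only [smul_sub]

/-- The potential of a Lipschitz density is Lipschitz in space and time. -/
theorem LipSlab.potential (hM : M.Admissible) (k l : ℝ) {f : ℝ → R3 → ℝ}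
    (hf : M.LipSlab fun p => f p.1 p.2) :
    M.LipSlab fun p => EulerAlignment.potential M.D k l (f p.1) p.2 := by
  obtain ⟨C, hC0, hC⟩ := hM.exists_majorant_bound
  obtain ⟨C', hC'0, hC'⟩ := exists_potential_bound (F := ℝ) hM k l
  obtain ⟨B, hB⟩ := hf.bound hM
  obtain ⟨K, hK⟩ := hf
  have hf : M.LipSlab fun p => f p.1 p.2 := ⟨K, hK⟩
  have hB0 : 0 ≤ max B 0 := le_max_right _ _
  refine ⟨(|k| * (1 + |l|) * (2 * C) * max B 0 + C' * K).toNNReal,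
    LipschitzOnWith.of_dist_le_mul ?_⟩
  rintro ⟨t, x⟩ ⟨ht, hx⟩ ⟨s, y⟩ ⟨hs, hy⟩
  rw [Real.coe_toNNReal _ (by positivity), add_mul]
  have hfs : ∀ {t : ℝ}, t ∈ Icc M.t₀ M.t_f → EssBounded M.xm (f t) := fun ht =>
    hf.essBounded_slice hM ht
  -- The space increment uses the difference bound for the kernel; the time increment is the
  -- potential of `f t - f s`, which is uniformly of size `K * dist t s`.
  refine (dist_triangle _ (EulerAlignment.potential M.D k l (f t) y) _).trans
    (add_le_add ?_ ?_)
  · rw [dist_eq_norm]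
    simp only [EulerAlignment.potential]
    rw [← integral_sub (integrable_yukawa_smul hM k l (hfs ht) hx)
      (integrable_yukawa_smul hM k l (hfs ht) hy)]
    calc _ ≤ ∫ z in M.D, |k| * (1 + |l|) * (majorant (x - z) + majorant (y - z)) * ‖x - y‖
            * max B 0 := by
          refine norm_integral_le_of_norm_le
            (((((hC x hx).1.add (hC y hy).1).const_mul _).mul_const _).mul_const _) ?_
          have hne : ∀ w : R3, ∀ᵐ z ∂M.xm, w - z ≠ 0 := fun w => by
            filter_upwards [Measure.ae_ne M.xm w] with z hz
            exact sub_ne_zero.2 hz.symm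
          filter_upwards [hM.ae_mem_slab ht, hne x, hne y] with z hz hzx hzy
          rw [← sub_smul, norm_smul]
          refine mul_le_mul ?_ ((hB _ hz).trans (le_max_left _ _)) (norm_nonneg _) ?_
          · have := abs_yukawa_sub_le k l hzx hzy
            rwa [sub_sub_sub_cancel_right] at this
          · have := majorant_nonneg (x - z)
            have := majorant_nonneg (y - z)
            positivity
      _ = |k| * (1 + |l|) * ((∫ z in M.D, majorant (x - z)) + ∫ z in M.D, majorant (y - z))
            * ‖x - y‖ * max B 0 := by
          rw [integral_mul_const, integral_mul_const, integral_const_mul,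
            integral_add (hC x hx).1 (hC y hy).1]
      _ ≤ |k| * (1 + |l|) * (C + C) * ‖x - y‖ * max B 0 := by
          gcongr
          exacts [(hC x hx).2, (hC y hy).2]
      _ = |k| * (1 + |l|) * (2 * C) * max B 0 * dist x y := by rw [dist_eq_norm]; ring
      _ ≤ _ := by
          gcongr
          exact le_max_right _ _
  · rw [dist_eq_norm]
    simp only
    rw [← potential_sub hM k l (hfs ht) (hfs hs) hy]
    refine (hC' _ (K * dist t s) ?_ y hy).trans ?_
    · filter_upwards [hM.ae_mem_slab ht, hM.ae_mem_slab hs] with z hz hz'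
      have h := hK.dist_le_mul _ hz _ hz'
      simp only [dist_eq_norm] at h ⊢
      refine h.trans (le_of_eq ?_)
      congr 1
      rw [Prod.mk_sub_mk, sub_self, Prod.norm_mk]
      simp
    · rw [mul_assoc]
      gcongr
      exact le_max_left _ _

/-- The potential of an essentially bounded field is essentially bounded. -/
theorem _root_.EulerAlignment.EssBounded.potential (hM : M.Admissible) (k l : ℝ) {a : ℝ → R3 → F}
    (ha : EssBounded M.qm fun p => a p.1 p.2) :
    EssBounded M.qm fun p => EulerAlignment.potential M.D k l (a p.1) p.2 := by
  have := hM.isFiniteMeasure_xm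
  obtain ⟨B, hB⟩ := ha.bound
  obtain ⟨C, hC0, hC⟩ := exists_potential_bound (F := F) hM k l
  refine ⟨?_, C * B, ?_⟩
  -- A measurable representative has the same potential for almost every time, by Fubini.
  · obtain ⟨b, hb, hab⟩ := ha.meas
    have hm : StronglyMeasurable fun q : (ℝ × R3) × R3 =>
        yukawa k l (q.1.2 - q.2) • b (q.1.1, q.2) := by
      refine StronglyMeasurable.smul ?_ (hb.comp_measurable (by fun_prop))
      exact ((measurable_yukawa k l).comp (by fun_prop)).stronglyMeasurable
    refine ⟨_, hm.integral_prod_right' (ν := M.xm), ?_⟩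
    have h1 := hM.ae_ae hab
    have h2 : ∀ᵐ p ∂M.qm, ∀ᵐ y ∂M.xm, a p.1 y = b (p.1, y) := by
      rw [qm_eq_prod]
      exact Measure.quasiMeasurePreserving_fst.ae h1
    filter_upwards [h2] with p hp
    refine integral_congr_ae ?_
    filter_upwards [hp] with y hy
    simp only [hy]
  · have h1 := hM.ae_ae hB
    have h2 : ∀ᵐ p ∂M.qm, ∀ᵐ y ∂M.xm, ‖a p.1 y‖ ≤ B := by
      rw [qm_eq_prod]
      exact Measure.quasiMeasurePreserving_fst.ae h1
    filter_upwards [h2, hM.ae_mem] with p hp hp'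
    exact hC _ _ hp _ (subset_closure hp'.2)

theorem _root_.EulerAlignment.EssBounded.potential_slice (hM : M.Admissible) (k l : ℝ) {a : R3 → F}
    (ha : EssBounded M.xm a) : EssBounded M.xm (EulerAlignment.potential M.D k l a) := by
  have := hM.isFiniteMeasure_xm
  obtain ⟨B, hB⟩ := ha.bound
  obtain ⟨C, hC0, hC⟩ := exists_potential_bound (F := F) hM k l
  refine ⟨?_, C * B, ?_⟩
  · have hm : AEStronglyMeasurable (fun q : R3 × R3 => yukawa k l (q.1 - q.2) • a q.2)
        (M.xm.prod M.xm) := by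
      refine AEStronglyMeasurable.smul ?_
        (ha.meas.comp_quasiMeasurePreserving Measure.quasiMeasurePreserving_snd)
      exact ((measurable_yukawa k l).comp (by fun_prop)).aestronglyMeasurable
    exact hm.integral_prod_right'
  · filter_upwards [ae_restrict_mem hM.isOpen_D.measurableSet] with x hx
    exact hC _ _ hB _ (subset_closure hx)

theorem integrable_majorant_prod (hM : M.Admissible) :
    Integrable (fun q : R3 × R3 => majorant (q.1 - q.2)) (M.xm.prod M.xm) := by
  have := hM.isFiniteMeasure_xm
  obtain ⟨C, hC0, hC⟩ := hM.exists_majorant_bound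
  have hmeas : Measurable fun q : R3 × R3 => majorant (q.1 - q.2) :=
    measurable_majorant.comp (by fun_prop)
  rw [integrable_prod_iff hmeas.aestronglyMeasurable]
  have hmem := ae_restrict_mem (μ := (volume : Measure R3)) hM.isOpen_D.measurableSet
  refine ⟨?_, ?_⟩
  · filter_upwards [hmem] with x hx using (hC x (subset_closure hx)).1
  · refine Integrable.of_bound (C := C) ?_ ?_
    · exact hmeas.aestronglyMeasurable.norm.integral_prod_right'
    · filter_upwards [hmem] with x hx
      simp only [Real.norm_of_nonneg (majorant_nonneg _)]
      rw [Real.norm_of_nonneg (integral_nonneg fun _ => majorant_nonneg _)]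
      exact (hC x (subset_closure hx)).2

/-- The Yukawa convolution is symmetric. -/
theorem integral_mul_potential_comm (hM : M.Admissible) (k l : ℝ) {f g : R3 → ℝ}
    (hf : EssBounded M.xm f) (hg : EssBounded M.xm g) :
    ∫ x in M.D, f x * potential M.D k l g x = ∫ x in M.D, g x * potential M.D k l f x := by
  have := hM.isFiniteMeasure_xm
  have h1 : ∀ (f g : R3 → ℝ), ∫ x in M.D, f x * potential M.D k l g x =
      ∫ x in M.D, ∫ y in M.D, f x * (yukawa k l (x - y) * g y) := fun f g => by
    simp only [potential, smul_eq_mul, integral_const_mul]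
  rw [h1, h1]
  have hi : Integrable (fun q : R3 × R3 => yukawa k l (q.1 - q.2)) (M.xm.prod M.xm) := by
    refine ((integrable_majorant_prod hM).const_mul |k|).mono' ?_
      (Eventually.of_forall fun q => abs_yukawa_le k l _)
    exact ((measurable_yukawa k l).comp (by fun_prop)).aestronglyMeasurable
  obtain ⟨B, hB⟩ := hf.bound
  obtain ⟨B', hB'⟩ := hg.bound
  have hi2 := (hi.mul_bdd (hg.meas.comp_quasiMeasurePreserving
    Measure.quasiMeasurePreserving_snd) (Measure.quasiMeasurePreserving_snd.ae hB')).bdd_mul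
    (hf.meas.comp_quasiMeasurePreserving
    Measure.quasiMeasurePreserving_fst) (Measure.quasiMeasurePreserving_fst.ae hB)
  rw [integral_integral_swap hi2]
  refine integral_congr_ae (Eventually.of_forall fun y => integral_congr_ae
    (Eventually.of_forall fun x => ?_))
  simp only
  rw [yukawa_sub_comm]
  ring

/-- Schur's test for the Yukawa kernel. -/
theorem exists_integral_inner_potential_le (hM : M.Admissible) (k l : ℝ) :
    ∃ C, 0 ≤ C ∧ ∀ a : R3 → R3, EssBounded M.xm a →
      ∫ x in M.D, ⟪a x, potential M.D k l a x⟫ ≤ C * ∫ x in M.D, ‖a x‖ ^ 2 := by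
  have := hM.isFiniteMeasure_xm
  obtain ⟨C, hC0, hC⟩ := hM.exists_majorant_bound
  refine ⟨|k| * C, by positivity, fun a ha => ?_⟩
  obtain ⟨B, hB⟩ := ha.bound
  have hmem := ae_restrict_mem (μ := (volume : Measure R3)) hM.isOpen_D.measurableSet
  have hn : EssBounded M.xm fun x => ‖a x‖ ^ 2 := ha.norm.comp (g := fun r : ℝ => r ^ 2) (by fun_prop)
  obtain ⟨B', hB'⟩ := hn.bound
  have hH : Integrable (fun q : R3 × R3 => |k| * (‖a q.1‖ ^ 2 * majorant (q.1 - q.2)))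
      (M.xm.prod M.xm) :=
    ((integrable_majorant_prod hM).bdd_mul (hn.meas.comp_quasiMeasurePreserving
      Measure.quasiMeasurePreserving_fst) (Measure.quasiMeasurePreserving_fst.ae hB')).const_mul _
  have hH' := hH.swap
  have hs : Integrable (fun q : R3 × R3 => (1 / 2) * (|k| * (‖a q.1‖ ^ 2 * majorant (q.1 - q.2))
      + |k| * (‖a q.2‖ ^ 2 * majorant (q.2 - q.1)))) (M.xm.prod M.xm) :=
    (hH.add hH').const_mul _
  calc ∫ x in M.D, ⟪a x, potential M.D k l a x⟫
      ≤ ∫ x in M.D, ∫ y in M.D, (1 / 2) * (|k| * (‖a x‖ ^ 2 * majorant (x - y))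
      + |k| * (‖a y‖ ^ 2 * majorant (y - x))) := by
        refine integral_mono_ae (ha.inner (ha.potential_slice hM k l)).integrable
          hs.integral_prod_left ?_
        filter_upwards [hmem, hs.prod_right_ae] with x hx hsx
        have hi := integrable_yukawa_smul hM k l ha (subset_closure hx)
        rw [potential, ← integral_inner hi]
        refine integral_mono_ae (hi.const_inner _) hsx (Eventually.of_forall fun y => ?_)
        have h1 : ⟪a x, a y⟫ * yukawa k l (x - y) ≤ (‖a x‖ * ‖a y‖) * (|k| * majorant (x - y)) := by
          refine (le_abs_self _).trans ?_
          rw [abs_mul]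
          exact mul_le_mul (abs_real_inner_le_norm _ _) (abs_yukawa_le k l _) (abs_nonneg _)
            (by positivity)
        -- The heart of Schur's test: the product is at most half the sum of the squares, and the
        -- two halves have equal integrals because the majorant is symmetric.
        have h2 : (‖a x‖ * ‖a y‖) * (|k| * majorant (x - y)) ≤
            (1 / 2 * (‖a x‖ ^ 2 + ‖a y‖ ^ 2)) * (|k| * majorant (x - y)) :=
          mul_le_mul_of_nonneg_right (by nlinarith [sq_nonneg (‖a x‖ - ‖a y‖)])
            (mul_nonneg (abs_nonneg _) (majorant_nonneg _))
        simp only [real_inner_smul_right]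
        rw [majorant_sub_comm y x]
        linarith
    _ = ∫ q, (1 / 2) * (|k| * (‖a q.1‖ ^ 2 * majorant (q.1 - q.2))
      + |k| * (‖a q.2‖ ^ 2 * majorant (q.2 - q.1))) ∂(M.xm.prod M.xm) := (integral_prod _ hs).symm
    _ = ∫ q, |k| * (‖a q.1‖ ^ 2 * majorant (q.1 - q.2)) ∂(M.xm.prod M.xm) := by
        have e := integral_prod_swap (μ := M.xm) (ν := M.xm)
          (fun q : R3 × R3 => |k| * (‖a q.1‖ ^ 2 * majorant (q.1 - q.2)))
        simp only [Prod.fst_swap, Prod.snd_swap] at e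
        rw [integral_const_mul, integral_add hH (by exact hH'), e]
        ring
    _ = ∫ x in M.D, |k| * (‖a x‖ ^ 2 * ∫ y in M.D, majorant (x - y)) := by
        rw [integral_prod _ hH]
        simp only [integral_const_mul]
    _ ≤ ∫ x in M.D, |k| * (‖a x‖ ^ 2 * C) := by
        refine integral_mono_ae ?_ ((hn.integrable.mul_const C).const_mul _) ?_
        · simpa only [integral_const_mul] using hH.integral_prod_left
        · filter_upwards [hmem] with x hx
          have := (hC x (subset_closure hx)).2
          beta_reduce
          gcongr
    _ = |k| * C * ∫ x in M.D, ‖a x‖ ^ 2 := by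
        rw [integral_const_mul, integral_mul_const]; ring

end System

/-- A relaxed balance `K τ - K₀ ≤ ∫ₐ^τ P`, integrated against a decreasing weight. -/
theorem integral_weight_mul_le {a b : ℝ} (hab : a ≤ b) {θ : ℝ → ℝ} (hθ : ContDiff ℝ 1 θ)
    (hb : θ b = 0) (hd : ∀ t, deriv θ t ≤ 0) {K P : ℝ → ℝ} {K₀ : ℝ}
    (hK : IntervalIntegrable K volume a b) (hP : IntervalIntegrable P volume a b)
    (h : ∀ᵐ τ ∂(volume.restrict (Icc a b)), K τ - K₀ ≤ ∫ t in a..τ, P t) :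
    -(∫ t in a..b, deriv θ t * K t) - θ a * K₀ ≤ ∫ t in a..b, θ t * P t := by
  have hd' : Continuous (deriv θ) := hθ.continuous_deriv le_rfl
  have hacG := hP.absolutelyContinuousOnInterval_intervalIntegral (c := a) left_mem_uIcc
  have hacθ : AbsolutelyContinuousOnInterval θ a b :=
    hθ.contDiffOn.absolutelyContinuousOnInterval
  -- The primitive of `P` is absolutely continuous, and integration by parts has no boundary terms:
  -- the primitive vanishes at `a` and `θ` at `b`. The sign of `θ'` then reverses the balance
  -- pointwise in `τ`.
  have hparts := hacθ.integral_mul_deriv_eq_deriv_mul hacG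
  rw [hb, intervalIntegral.integral_same, zero_mul, mul_zero, sub_zero, zero_sub] at hparts
  have hG' : ∫ t in a..b, θ t * deriv (fun x => ∫ t in a..x, P t) t = ∫ t in a..b, θ t * P t := by
    refine intervalIntegral.integral_congr_ae ?_
    filter_upwards [hP.ae_hasDerivAt_integral] with t ht ht'
    rw [(ht (uIoc_subset_uIcc ht') a left_mem_uIcc).deriv]
  have hθint : ∫ t in a..b, deriv θ t = -θ a := by
    rw [intervalIntegral.integral_deriv_eq_sub (fun t _ => hθ.differentiable (by simp) t)
      (hd'.intervalIntegrable _ _), hb, zero_sub]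
  have hle : ∫ t in a..b, deriv θ t * ∫ s in a..t, P s ≤ ∫ t in a..b, deriv θ t * (K t - K₀) := by
    refine intervalIntegral.integral_mono_ae_restrict hab ?_ ?_ ?_
    · exact (hacG.continuousOn.intervalIntegrable).continuousOn_mul hd'.continuousOn
    · exact (hK.sub intervalIntegrable_const).continuousOn_mul hd'.continuousOn
    · filter_upwards [h] with t ht
      exact mul_le_mul_of_nonpos_left ht (hd t)
  have hsplit : ∫ t in a..b, deriv θ t * (K t - K₀) =
      (∫ t in a..b, deriv θ t * K t) + θ a * K₀ := by
    simp only [mul_sub]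
    rw [intervalIntegral.integral_sub (hK.continuousOn_mul hd'.continuousOn)
      ((hd'.intervalIntegrable _ _).mul_const _), intervalIntegral.integral_mul_const, hθint]
    ring
  linarith

theorem integral_add₃ {X : Type*} [MeasurableSpace X] {μ : Measure X} {f g h : X → ℝ}
    (hf : Integrable f μ) (hg : Integrable g μ) (hh : Integrable h μ) :
    ∫ x, (f x + g x + h x) ∂μ = (∫ x, f x ∂μ) + (∫ x, g x ∂μ) + ∫ x, h x ∂μ := by
  rw [← integral_add hf hg, ← integral_add (by exact hf.add hg) hh]

namespace System

variable {M : System}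

/-! ### Time derivatives of spatial integrals -/

/-- Serves to differentiate a product in time with one factor held at a fixed time. -/
theorem LipSlab.freeze {E : Type*} [NormedAddCommGroup E] {f : ℝ × R3 → E} (hf : M.LipSlab f)
    {t : ℝ} (ht : t ∈ Icc M.t₀ M.t_f) : M.LipSlab fun p => f (t, p.2) := by
  obtain ⟨K, hK⟩ := hf
  have h2 : LipschitzOnWith 1 (fun p : ℝ × R3 => (t, p.2)) M.slab := by
    have := ((LipschitzWith.const t).prodMk
      (LipschitzWith.prod_snd (α := ℝ) (β := R3))).lipschitzOnWith (s := M.slab)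
    simpa using this
  exact ⟨_, hK.comp h2 fun p hp => ⟨ht, hp.2⟩⟩

theorem hasDerivAt_integral (hM : M.Admissible) {g : ℝ × R3 → ℝ} (hg : M.LipSlab g) {t : ℝ}
    (ht : t ∈ Ioo M.t₀ M.t_f) {g' : R3 → ℝ} (hm : AEStronglyMeasurable g' M.xm)
    (hd : ∀ᵐ x ∂M.xm, HasDerivAt (fun s => g (s, x)) (g' x) t) :
    HasDerivAt (fun s => ∫ x in M.D, g (s, x)) (∫ x in M.D, g' x) t := by
  have := hM.isFiniteMeasure_xm
  obtain ⟨K, hK⟩ := id hg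
  have hs : Ioo M.t₀ M.t_f ∈ 𝓝 t := Ioo_mem_nhds ht.1 ht.2
  refine (hasDerivAt_integral_of_dominated_loc_of_lip (bound := fun _ => (K : ℝ)) hs ?_ ?_ hm ?_
    (integrable_const _) hd).2
  · filter_upwards [hs] with s hs using (hg.essBounded_slice hM (Ioo_subset_Icc_self hs)).meas
  · exact (hg.essBounded_slice hM (Ioo_subset_Icc_self ht)).integrable
  · filter_upwards [hM.ae_mem_slab (Ioo_subset_Icc_self ht)] with x hx
    refine LipschitzOnWith.of_dist_le_mul fun s hs s' hs' => ?_
    have h := hK.dist_le_mul (s, x) ⟨Ioo_subset_Icc_self hs, hx.2⟩ (s', x)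
      ⟨Ioo_subset_Icc_self hs', hx.2⟩
    simpa using h

/-- The spatial integral of `g` is Lipschitz in time, so the fundamental theorem of calculus applies
to it, and for almost every time its derivative may be taken under the integral. -/
theorem integral_fderiv_time (hM : M.Admissible) {g : ℝ × R3 → ℝ} (hg : M.LipSlab g) :
    ∫ p, fderiv ℝ g p (1, 0) ∂M.qm =
      (∫ x in M.D, g (M.t_f, x)) - ∫ x in M.D, g (M.t₀, x) := by
  have := hM.isFiniteMeasure_xm
  have := hM.isFiniteMeasure_qm
  obtain ⟨K, hK⟩ := id hg
  have hac : AbsolutelyContinuousOnInterval (fun s => ∫ x in M.D, g (s, x)) M.t₀ M.t_f := by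
    refine LipschitzOnWith.absolutelyContinuousOnInterval
      (K := (K * volume.real M.D).toNNReal) (LipschitzOnWith.of_dist_le_mul fun s hs s' hs' => ?_)
    rw [uIcc_of_le hM.time_lt.le] at hs hs'
    rw [Real.coe_toNNReal _ (by positivity), dist_eq_norm,
      ← integral_sub (hg.essBounded_slice hM hs).integrable
        (hg.essBounded_slice hM hs').integrable]
    have : ∀ᵐ x ∂M.xm, ‖g (s, x) - g (s', x)‖ ≤ K * dist s s' := by
      filter_upwards [hM.ae_mem_slab hs, hM.ae_mem_slab hs'] with x hx hx'
      have h := hK.dist_le_mul _ hx _ hx'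
      rw [dist_eq_norm (g _)] at h
      simpa using h
    refine (norm_integral_le_of_norm_le_const this).trans (le_of_eq ?_)
    simp [Measure.real]
    ring
  rw [← hac.integral_deriv_eq_sub,
    hM.integral_qm ((hg.essBounded_fderiv hM).clm_apply (EssBounded.const _)).integrable]
  rw [intervalIntegral.integral_of_le hM.time_lt.le, intervalIntegral.integral_of_le hM.time_lt.le,
    integral_Ioc_eq_integral_Ioo, integral_Ioc_eq_integral_Ioo]
  refine integral_congr_ae ?_
  filter_upwards [hM.ae_ae (hg.ae_differentiableAt hM), ae_restrict_mem measurableSet_Ioo]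
    with t ht ht'
  refine (hasDerivAt_integral hM hg ht' ?_ ?_).deriv.symm
  · exact (((measurable_fderiv_apply_const ℝ g (1, 0)).comp measurable_prodMk_left)).aestronglyMeasurable
  · filter_upwards [ht] with x hx
    exact hasDerivAt_slice (f := fun s x => g (s, x)) hx

variable {ρ : ℝ → R3 → ℝ} {j : ℝ → R3 → R3}

/-- By symmetry of the kernel, `∫ ρ(s) Φ[ρ(t)]` and `∫ ρ(t) Φ[ρ(s)]` agree as functions of `s`; the
claim compares their derivatives at `s = t`. No formula for the time derivative of the potential is
needed. -/
theorem integral_fderiv_mul_potential (hM : M.Admissible) (hρ : M.IsDensity ρ) (k l : ℝ) :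
    ∀ᵐ t ∂M.tm, ∫ x in M.D, fderiv ℝ (fun p : ℝ × R3 => ρ p.1 p.2) (t, x) (1, 0) *
        potential M.D k l (ρ t) x =
      ∫ x in M.D, ρ t x *
        fderiv ℝ (fun p : ℝ × R3 => potential M.D k l (ρ p.1) p.2) (t, x) (1, 0) := by
  have hl := hρ.lipSlab
  have hΦ := hl.potential hM k l
  filter_upwards [hM.ae_ae (hl.ae_differentiableAt hM), hM.ae_ae (hΦ.ae_differentiableAt hM),
    ae_restrict_mem measurableSet_Ioo] with t h1 h2 ht
  have ht' := Ioo_subset_Icc_self ht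
  have d1 := hasDerivAt_integral hM (hl.mul hM (hΦ.freeze ht')) ht
    (g' := fun x => fderiv ℝ (fun p : ℝ × R3 => ρ p.1 p.2) (t, x) (1, 0) *
        potential M.D k l (ρ t) x) ?_ ?_
  · have d2 := hasDerivAt_integral hM ((hl.freeze ht').mul hM hΦ) ht
      (g' := fun x => ρ t x *
        fderiv ℝ (fun p : ℝ × R3 => potential M.D k l (ρ p.1) p.2) (t, x) (1, 0)) ?_ ?_
    · refine d1.unique (d2.congr_of_eventuallyEq ?_)
      filter_upwards [Ioo_mem_nhds ht.1 ht.2] with s hs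
      exact integral_mul_potential_comm hM k l
        (hl.essBounded_slice hM (Ioo_subset_Icc_self hs)) (hl.essBounded_slice hM ht')
    · exact (hl.essBounded_slice hM ht').meas.mul
        ((measurable_fderiv_apply_const ℝ _ (1, 0)).comp measurable_prodMk_left).aestronglyMeasurable
    · filter_upwards [h2] with x hx
      exact (hasDerivAt_slice (f := fun s x => potential M.D k l (ρ s) x) hx).const_mul _
  · exact ((measurable_fderiv_apply_const ℝ _ (1, 0)).comp
      measurable_prodMk_left).aestronglyMeasurable.mul (hΦ.essBounded_slice hM ht').meas
  · filter_upwards [h1] with x hx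
    exact (hasDerivAt_slice (f := ρ) hx).mul_const _

theorem lipSlab_weight (hM : M.Admissible) {θ : ℝ → ℝ} (hθ : ContDiff ℝ 1 θ) :
    M.LipSlab fun p => θ p.1 := LipSlab.fst.comp hM hθ

theorem fderiv_weight_smul {F : Type*} [NormedAddCommGroup F] [NormedSpace ℝ F] {θ : ℝ → ℝ}
    (hθ : ContDiff ℝ 1 θ) {f : ℝ × R3 → F} {p : ℝ × R3} (hf : DifferentiableAt ℝ f p)
    (a : ℝ) (q : R3) :
    fderiv ℝ (fun p : ℝ × R3 => θ p.1 • f p) p (a, q) =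
      θ p.1 • fderiv ℝ f p (a, q) + (deriv θ p.1 * a) • f p := by
  have h1 : HasFDerivAt (fun p : ℝ × R3 => θ p.1)
      ((ContinuousLinearMap.toSpanSingleton ℝ (deriv θ p.1)).comp
        (ContinuousLinearMap.fst ℝ ℝ R3)) p :=
    ((hθ.differentiable (by simp) p.1).hasDerivAt.hasFDerivAt).comp p hasFDerivAt_fst
  have h2 : HasFDerivAt (fun p : ℝ × R3 => θ p.1 • f p) _ p := h1.smul hf.hasFDerivAt
  rw [h2.fderiv]
  simp [mul_comm]

/-- The balance of the potential energy, tested with a weight vanishing at the final time. -/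
theorem integral_weight_fderiv_potential (hM : M.Admissible) (hρ : M.IsDensity ρ)
    (hj : M.IsMomentum j) (hw : M.WeakContinuity ρ j) (k l : ℝ) {θ : ℝ → ℝ}
    (hθ : ContDiff ℝ 1 θ) (hf : θ M.t_f = 0) :
    ∫ p, θ p.1 * fderiv ℝ (fun p : ℝ × R3 => potential M.D k l (ρ p.1) p.2) p (0, j p.1 p.2) ∂M.qm
      = -(1 / 2) * (θ M.t₀ * (∫ x in M.D, ρ M.t₀ x * potential M.D k l (ρ M.t₀) x)
        + ∫ p, deriv θ p.1 * (ρ p.1 p.2 * potential M.D k l (ρ p.1) p.2) ∂M.qm) := by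
  have := hM.isFiniteMeasure_qm
  have hl := hρ.lipSlab
  have hΦ := hl.potential hM k l
  have hθl := lipSlab_weight hM hθ
  have hθ' : EssBounded M.qm fun p => deriv θ p.1 :=
    (LipSlab.fst.essBounded hM).comp (hθ.continuous_deriv le_rfl)
  set Φ : ℝ × R3 → ℝ := fun p => potential M.D k l (ρ p.1) p.2 with hΦdef
  set r : ℝ × R3 → ℝ := fun p => ρ p.1 p.2 with hr
  have bθ := hθl.essBounded hM
  have br := hl.essBounded hM
  have bΦ := hΦ.essBounded hM
  have brt : EssBounded M.qm fun p => fderiv ℝ r p (1, 0) :=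
    (hl.essBounded_fderiv hM).clm_apply (EssBounded.const _)
  have bΦt : EssBounded M.qm fun p => fderiv ℝ Φ p (1, 0) :=
    (hΦ.essBounded_fderiv hM).clm_apply (EssBounded.const _)
  have bΦx : EssBounded M.qm fun p => fderiv ℝ Φ p (0, j p.1 p.2) :=
    (hΦ.essBounded_fderiv hM).clm_apply ((EssBounded.const _).prodMk hj.essBounded)
  have i1 := (hθ'.mul (br.mul bΦ)).integrable
  have i2 := (bθ.mul (br.mul bΦt)).integrable
  have i2' := (bθ.mul (brt.mul bΦ)).integrable
  have i3 := (bθ.mul bΦx).integrable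
  -- The continuity equation tested with `θ Φ` contains `∫ θ ρ ∂ₜΦ` once. The fundamental theorem
  -- for `θ ρ Φ` contains it twice, by symmetry. Eliminating it produces the factor `1/2`.
  have hWC := hw.lipschitz hM hρ hj (hθl.smul hM hΦ)
  have hFTC := integral_fderiv_time hM (hθl.smul hM (hl.mul hM hΦ))
  have hsym : ∫ p, θ p.1 * (fderiv ℝ r p (1, 0) * Φ p) ∂M.qm =
      ∫ p, θ p.1 * (r p * fderiv ℝ Φ p (1, 0)) ∂M.qm := by
    rw [hM.integral_qm i2, hM.integral_qm i2', intervalIntegral.integral_of_le hM.time_lt.le,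
      intervalIntegral.integral_of_le hM.time_lt.le,
      integral_Ioc_eq_integral_Ioo, integral_Ioc_eq_integral_Ioo]
    refine integral_congr_ae ?_
    filter_upwards [integral_fderiv_mul_potential hM hρ k l] with t ht
    rw [integral_const_mul, integral_const_mul]
    exact congrArg _ ht
  have e1 : ∫ p, fderiv ℝ (fun p => θ p.1 • Φ p) p (ρ p.1 p.2, j p.1 p.2) ∂M.qm =
      (∫ p, deriv θ p.1 * (r p * Φ p) ∂M.qm) + (∫ p, θ p.1 * (r p * fderiv ℝ Φ p (1, 0)) ∂M.qm)
        + ∫ p, θ p.1 * fderiv ℝ Φ p (0, j p.1 p.2) ∂M.qm := by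
    rw [← integral_add₃ i1 i2 i3]
    refine integral_congr_ae ?_
    filter_upwards [hΦ.ae_differentiableAt hM] with p hp
    rw [fderiv_weight_smul hθ hp, apply_time_space]
    simp only [smul_eq_mul, hr]
    ring
  have e2 : ∫ p, fderiv ℝ (fun p => θ p.1 • (r p * Φ p)) p (1, 0) ∂M.qm =
      (∫ p, deriv θ p.1 * (r p * Φ p) ∂M.qm) + (∫ p, θ p.1 * (r p * fderiv ℝ Φ p (1, 0)) ∂M.qm)
        + ∫ p, θ p.1 * (fderiv ℝ r p (1, 0) * Φ p) ∂M.qm := by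
    rw [← integral_add₃ i1 i2 i2']
    refine integral_congr_ae ?_
    filter_upwards [hΦ.ae_differentiableAt hM, hl.ae_differentiableAt hM] with p hp hp'
    have hrΦ : HasFDerivAt (fun p => r p * Φ p) _ p := hp'.hasFDerivAt.mul hp.hasFDerivAt
    rw [fderiv_weight_smul hθ hrΦ.differentiableAt, hrΦ.fderiv]
    simp only [smul_eq_mul, add_apply, smul_apply]
    ring
  rw [e1] at hWC
  rw [e2, hsym] at hFTC
  simp only [hf, zero_mul, mul_zero, integral_zero, zero_sub, smul_eq_mul] at hWC hFTC
  have e3 : ∫ x in M.D, ρ M.t₀ x * (θ M.t₀ * Φ (M.t₀, x)) =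
      θ M.t₀ * ∫ x in M.D, ρ M.t₀ x * Φ (M.t₀, x) := by
    rw [← integral_const_mul]; congr! 2; ring
  have e4 : ∫ x in M.D, θ M.t₀ * (r (M.t₀, x) * Φ (M.t₀, x)) =
      θ M.t₀ * ∫ x in M.D, ρ M.t₀ x * Φ (M.t₀, x) := by
    rw [← integral_const_mul]
  rw [e3] at hWC
  rw [e4] at hFTC
  simp only [hΦdef, hr] at *
  linarith

end System

theorem sum_smul_basisVec (q : R3) : ∑ b, q b • basisVec b = q := by
  ext a
  fin_cases a <;> simp [basisVec, Fin.sum_univ_three]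

namespace System

variable {M : System} {ρ : ℝ → R3 → ℝ} {j i : ℝ → R3 → R3} {j₀ : R3 → R3}

/-! ### Boundedness of the source -/

theorem essBounded_gradient_potential (hM : M.Admissible) (hρ : M.IsDensity ρ) (k l : ℝ) :
    EssBounded M.qm fun p => gradient (potential M.D k l (ρ p.1)) p.2 := by
  have hΦ := hρ.lipSlab.potential hM k l
  have h := (hΦ.essBounded_fderiv hM).comp (g := fun L : ℝ × R3 →L[ℝ] ℝ =>
    (InnerProductSpace.toDual ℝ R3).symm (L.comp (ContinuousLinearMap.inr ℝ ℝ R3)))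
    ((InnerProductSpace.toDual ℝ R3).symm.continuous.comp (by fun_prop))
  refine h.congr ?_
  filter_upwards [hΦ.ae_differentiableAt hM] with p hp
  rw [gradient, (hasFDerivAt_slice (f := fun t => potential M.D k l (ρ t)) hp).fderiv]
  rfl

theorem essBounded_gradient_U (hM : M.Admissible) :
    EssBounded M.qm fun p => gradient M.U p.2 := by
  obtain ⟨K, hK⟩ := hM.U_lip
  refine ⟨?_, K, ?_⟩
  · exact ((InnerProductSpace.toDual ℝ R3).symm.continuous.measurable.comp
      ((measurable_fderiv ℝ M.U).comp measurable_snd)).aestronglyMeasurable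
  · filter_upwards [hM.ae_mem] with p hp
    rw [gradient, LinearIsometryEquiv.norm_map]
    exact norm_fderiv_le_of_lipschitzOn ℝ
      (mem_of_superset (hM.isOpen_D.mem_nhds hp.2) subset_closure) hK

theorem essBounded_source (hM : M.Admissible) (hρ : M.IsDensity ρ)
    (hj : EssBounded M.qm fun p => j p.1 p.2) :
    EssBounded M.qm fun p => M.source (ρ p.1) (j p.1) p.2 := by
  have := hM.isFiniteMeasure_qm
  have br := hρ.lipSlab.essBounded hM
  have bP : EssBounded M.qm fun p => M.P ((ρ p.1 p.2)⁻¹ * ‖j p.1 p.2‖) :=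
    (((hρ.lipSlab_inv hM).essBounded hM).mul hj.norm).comp hM.P_smooth.continuous
  exact (((br.smul (hj.potential hM M.k_a M.l_a)).sub
    ((br.potential hM M.k_a M.l_a).smul hj)).sub (br.smul
      (((essBounded_gradient_potential hM hρ M.k_c M.l_c).add
        (essBounded_gradient_potential hM hρ M.k_r M.l_r)).add (essBounded_gradient_U hM)))).add
    (((EssBounded.const M.κ_p).mul ((EssBounded.const (1 : ℝ)).sub bP)).smul hj)

/-! ### The velocity of the Lipschitz solution -/

theorem IsLipschitzSolution.lipSlab (hi : M.IsLipschitzSolution j₀ ρ i) :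
    M.LipSlab fun p => i p.1 p.2 := hi.lip

theorem IsLipschitzSolution.lipSlab_velocity (hM : M.Admissible) (hρ : M.IsDensity ρ)
    (hi : M.IsLipschitzSolution j₀ ρ i) : M.LipSlab fun p => (ρ p.1 p.2)⁻¹ • i p.1 p.2 :=
  (hρ.lipSlab_inv hM).smul hM hi.lipSlab

theorem IsDensity.ae_pos (hM : M.Admissible) (hρ : M.IsDensity ρ) :
    ∀ᵐ p ∂M.qm, 0 < ρ p.1 p.2 := by
  filter_upwards [hM.ae_mem] with p hp
  have := mem_of_mem_nhds (hM.slab_mem_nhds hp)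
  exact hρ.pos p.1 this.1 p.2 this.2

/-- The velocity `v = ρ⁻¹ i` satisfies `ρ ∂ₜ v + (Dv) i = S[ρ, i]` almost everywhere. -/
theorem IsLipschitzSolution.fderiv_velocity (hM : M.Admissible) (hρ : M.IsDensity ρ)
    (hi : M.IsLipschitzSolution j₀ ρ i) :
    ∀ᵐ p ∂M.qm, fderiv ℝ (fun p : ℝ × R3 => (ρ p.1 p.2)⁻¹ • i p.1 p.2) p (ρ p.1 p.2, i p.1 p.2) =
      M.source (ρ p.1) (i p.1) p.2 := by
  have hv := hi.lipSlab_velocity hM hρ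
  filter_upwards [hρ.lipSlab.ae_differentiableAt hM, hi.lipSlab.ae_differentiableAt hM,
    hv.ae_differentiableAt hM, hM.ae_mem, hi.continuity_eq, hi.momentum_eq]
    with p hr hd hvd hp hc hm
  set v : ℝ × R3 → R3 := fun p => (ρ p.1 p.2)⁻¹ • i p.1 p.2 with hvdef
  have dr := hr.hasFDerivAt
  have dv := hvd.hasFDerivAt
  have heq : (fun p : ℝ × R3 => i p.1 p.2) =ᶠ[𝓝 p] fun p => ρ p.1 p.2 • v p := by
    filter_upwards [hM.slab_mem_nhds hp] with q hq
    rw [hvdef, smul_inv_smul₀ (hρ.pos q.1 hq.1 q.2 hq.2).ne']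
  have di : HasFDerivAt (fun p : ℝ × R3 => i p.1 p.2) _ p := (dr.smul dv).congr_of_eventuallyEq heq
  have e1 := (hasDerivAt_slice (f := i) hd).deriv
  have e2 := (hasFDerivAt_slice (f := i) hd).fderiv
  have e3 := (hasDerivAt_slice (f := ρ) hr).deriv
  -- The flux is written as `i_b v`. Its product rule leaves `v div i`, which the continuity
  -- equation cancels against the `v ∂ₜρ` coming from `∂ₜ(ρ v)`.
  have hflux : ∀ b, fderiv ℝ (fun y => ((ρ p.1 y)⁻¹ * i p.1 y b) • i p.1 y) p.2 (basisVec b) =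
      i p.1 p.2 b • fderiv ℝ v p (0, basisVec b)
        + (fderiv ℝ (Function.uncurry i) p (0, basisVec b)) b • v p := by
    intro b
    have f1 : (fun y => ((ρ p.1 y)⁻¹ * i p.1 y b) • i p.1 y) = fun y => i p.1 y b • v (p.1, y) := by
      funext y
      rw [hvdef, smul_smul, mul_comm]
    have f2 : HasFDerivAt (fun y => i p.1 y b) ((EuclideanSpace.proj (𝕜 := ℝ) b).comp
        ((fderiv ℝ (Function.uncurry i) p).comp (ContinuousLinearMap.inr ℝ ℝ R3))) p.2 :=
      (EuclideanSpace.proj (𝕜 := ℝ) b).hasFDerivAt.comp p.2 (hasFDerivAt_slice (f := i) hd)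
    have f3 := hasFDerivAt_slice (f := fun t x => v (t, x)) (p := p) hvd
    have f4 : HasFDerivAt (fun y => i p.1 y b • v (p.1, y)) _ p.2 := f2.smul f3
    rw [f1, f4.fderiv]
    rfl
  have hsum : ∑ b, i p.1 p.2 b • fderiv ℝ v p (0, basisVec b) = fderiv ℝ v p (0, i p.1 p.2) := by
    conv_rhs => rw [← sum_smul_basisVec (i p.1 p.2)]
    have := map_sum ((fderiv ℝ v p).comp (ContinuousLinearMap.inr ℝ ℝ R3))
      (fun b => i p.1 p.2 b • basisVec b) Finset.univ
    simp only [map_smul] at this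
    exact this.symm
  have hdi : fderiv ℝ (Function.uncurry i) p (1, 0) =
      ρ p.1 p.2 • fderiv ℝ v p (1, 0) +
        (fderiv ℝ (Function.uncurry ρ) p (1, 0)) • v p := by
    have : fderiv ℝ (Function.uncurry i) p = _ := di.fderiv
    rw [this]
    rfl
  rw [← hm, apply_time_space, e1, hdi, Finset.sum_congr rfl fun b _ => hflux b,
    Finset.sum_add_distrib, hsum, ← Finset.sum_smul]
  rw [e3, e2] at hc
  have hc' : ∑ b, (fderiv ℝ (Function.uncurry i) p (0, basisVec b)) b =
      -fderiv ℝ (Function.uncurry ρ) p (1, 0) := by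
    rw [eq_neg_iff_add_eq_zero, add_comm]
    exact hc
  rw [hc', neg_smul]
  abel

end System

/-- The algebra behind the relative energy inequality, at a point, with `j = r w` and `i = r v`. -/
theorem relative_energy_identity {E : Type*} [NormedAddCommGroup E] [InnerProductSpace ℝ E]
    {r : ℝ} (hr : 0 < r) (π κ Pv Pw : ℝ) (v w πi πj gc gr gU A : E) :
    (⟪r • w, πj⟫ - r⁻¹ * ‖r • w‖ ^ 2 * π - ⟪r • w, gU⟫ + κ * (r⁻¹ * ‖r • w‖ ^ 2) * (1 - Pw))
      - (⟪r • w, gc⟫ + ⟪r • w, gr⟫)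
      + ⟪v - w, (r • πi - π • (r • v) - r • (gc + gr + gU) + (κ * (1 - Pv)) • (r • v)) + A⟫
      - ⟪v, r • πj - π • (r • w) - r • (gc + gr + gU) + (κ * (1 - Pw)) • (r • w)⟫ =
    r * ⟪v - w, πi - πj⟫ - r * ‖v - w‖ ^ 2 * π
      + r * ⟪v - w, (κ * (1 - Pv)) • v - (κ * (1 - Pw)) • w⟫ + ⟪v - w, A⟫ := by
  have h1 : r⁻¹ * ‖r • w‖ ^ 2 = r * ⟪w, w⟫ := by
    rw [norm_smul, mul_pow, Real.norm_of_nonneg hr.le, real_inner_self_eq_norm_sq]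
    field_simp
  have h2 : ‖v - w‖ ^ 2 = ⟪v, v⟫ - 2 * ⟪v, w⟫ + ⟪w, w⟫ := by
    rw [norm_sub_sq_real, real_inner_self_eq_norm_sq, real_inner_self_eq_norm_sq]
  rw [h1, h2]
  -- All terms with `gc`, `gr` and `gU` cancel here, because the two sources carry the same density
  -- `r`.
  simp only [inner_sub_left, inner_sub_right, inner_add_right, real_inner_smul_left,
    real_inner_smul_right, real_inner_comm v w]
  ring

theorem EssBounded.ae_slice {E : Type*} [NormedAddCommGroup E] {M : System} (hM : M.Admissible)
    {f : ℝ × R3 → E} (hf : EssBounded M.qm f) :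
    ∀ᵐ t ∂M.tm, EssBounded M.xm fun x => f (t, x) := by
  have := hM.isFiniteMeasure_xm
  obtain ⟨C, hC⟩ := hf.bound
  have h1 := hf.meas
  rw [System.qm_eq_prod] at h1
  filter_upwards [hM.ae_ae hC, h1.prodMk_left] with t ht ht'
  exact ⟨ht', C, ht⟩

theorem EssBounded.norm_sq {X E : Type*} [MeasurableSpace X] {μ : Measure X}
    [NormedAddCommGroup E] {f : X → E} (hf : EssBounded μ f) : EssBounded μ fun x => ‖f x‖ ^ 2 :=
  hf.norm.comp (g := fun r : ℝ => r ^ 2) (by fun_prop)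

namespace System

variable {M : System} {ρ : ℝ → R3 → ℝ} {j i : ℝ → R3 → R3} {j₀ : R3 → R3}

theorem intervalIntegrable_integral (hM : M.Admissible) {f : ℝ × R3 → ℝ}
    (hf : EssBounded M.qm f) :
    IntervalIntegrable (fun t => ∫ x in M.D, f (t, x)) volume M.t₀ M.t_f := by
  have := hM.isFiniteMeasure_xm
  have := hM.isFiniteMeasure_qm
  have h := hf.integrable
  rw [qm_eq_prod] at h
  rw [intervalIntegrable_iff_integrableOn_Ioo_of_le hM.time_lt.le]
  exact h.integral_prod_left

/-- The integrand of the power. -/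
def powerDensity (M : System) (r : R3 → ℝ) (q : R3 → R3) (x : R3) : ℝ :=
  ⟪q x, M.alignPot q x⟫ - (r x)⁻¹ * ‖q x‖ ^ 2 * M.alignPot r x
    - ⟪q x, gradient M.U x⟫
    + M.κ_p * ((r x)⁻¹ * ‖q x‖ ^ 2) * (1 - M.P ‖(r x)⁻¹ • q x‖)

theorem essBounded_powerDensity (hM : M.Admissible) (hρ : M.IsDensity ρ)
    (hj : EssBounded M.qm fun p => j p.1 p.2) :
    EssBounded M.qm fun p => M.powerDensity (ρ p.1) (j p.1) p.2 := by
  have := hM.isFiniteMeasure_qm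
  have br := hρ.lipSlab.essBounded hM
  have bi := (hρ.lipSlab_inv hM).essBounded hM
  have bw := bi.mul hj.norm_sq
  have bP : EssBounded M.qm fun p => M.P ‖(ρ p.1 p.2)⁻¹ • j p.1 p.2‖ :=
    (bi.smul hj).norm.comp hM.P_smooth.continuous
  exact (((hj.inner (hj.potential hM M.k_a M.l_a)).sub
    (bw.mul (br.potential hM M.k_a M.l_a))).sub (hj.inner (essBounded_gradient_U hM))).add
    (((EssBounded.const M.κ_p).mul bw).mul ((EssBounded.const (1 : ℝ)).sub bP))

/-- The kinetic part of the energy inequality, tested with a decreasing weight. -/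
theorem EnergyInequality.weighted (hM : M.Admissible) (hρ : M.IsDensity ρ)
    (hj : M.IsMomentum j) (hc : M.WeakContinuity ρ j) (he : M.EnergyInequality ρ j)
    (hj₀ : EssBounded M.xm (j M.t₀)) {θ : ℝ → ℝ} (hθ : ContDiff ℝ 1 θ) (hf : θ M.t_f = 0)
    (hd : ∀ t, deriv θ t ≤ 0) :
    -(∫ p, deriv θ p.1 * (1 / 2 * ((ρ p.1 p.2)⁻¹ * ‖j p.1 p.2‖ ^ 2)) ∂M.qm)
      - θ M.t₀ * (1 / 2 * ∫ x in M.D, (ρ M.t₀ x)⁻¹ * ‖j M.t₀ x‖ ^ 2)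
      + (∫ p, θ p.1 * fderiv ℝ (fun p : ℝ × R3 => potential M.D M.k_r M.l_r (ρ p.1) p.2) p
          (0, j p.1 p.2) ∂M.qm)
      + (∫ p, θ p.1 * fderiv ℝ (fun p : ℝ × R3 => potential M.D M.k_c M.l_c (ρ p.1) p.2) p
          (0, j p.1 p.2) ∂M.qm)
      ≤ ∫ p, θ p.1 * M.powerDensity (ρ p.1) (j p.1) p.2 ∂M.qm := by
  have := hM.isFiniteMeasure_xm
  have := hM.isFiniteMeasure_qm
  have hl := hρ.lipSlab
  have br := hl.essBounded hM
  have bk := ((hρ.lipSlab_inv hM).essBounded hM).mul hj.essBounded.norm_sq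
  have bΦr := br.mul ((hl.potential hM M.k_r M.l_r).essBounded hM)
  have bΦc := br.mul ((hl.potential hM M.k_c M.l_c).essBounded hM)
  have bpw := essBounded_powerDensity hM hρ hj.essBounded
  have bθ := (lipSlab_weight hM hθ).essBounded hM
  have bθ' : EssBounded M.qm fun p => deriv θ p.1 :=
    (LipSlab.fst.essBounded hM).comp (hθ.continuous_deriv le_rfl)
  have hK : IntervalIntegrable (fun t => M.energy (ρ t) (j t)) volume M.t₀ M.t_f :=
    (intervalIntegrable_integral hM ((bk.add bΦr).add bΦc)).const_mul (1 / 2)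
  have hP : IntervalIntegrable (fun t => M.power (ρ t) (j t)) volume M.t₀ M.t_f :=
    intervalIntegrable_integral hM bpw
  have key := integral_weight_mul_le hM.time_lt.le hθ hf hd hK hP he
  have e1 : ∫ t in M.t₀..M.t_f, deriv θ t * M.energy (ρ t) (j t) =
      (∫ p, deriv θ p.1 * (1 / 2 * ((ρ p.1 p.2)⁻¹ * ‖j p.1 p.2‖ ^ 2)) ∂M.qm)
      + 1 / 2 * (∫ p, deriv θ p.1 * (ρ p.1 p.2 *
          potential M.D M.k_r M.l_r (ρ p.1) p.2) ∂M.qm)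
      + 1 / 2 * ∫ p, deriv θ p.1 * (ρ p.1 p.2 *
          potential M.D M.k_c M.l_c (ρ p.1) p.2) ∂M.qm := by
    rw [← integral_const_mul, ← integral_const_mul, ← integral_add₃
      (bθ'.mul ((EssBounded.const (1 / 2 : ℝ)).mul bk)).integrable
      ((bθ'.mul bΦr).integrable.const_mul _) ((bθ'.mul bΦc).integrable.const_mul _)]
    rw [hM.integral_qm (by exact ((bθ'.mul ((EssBounded.const (1 / 2 : ℝ)).mul bk)).integrable.add
      ((bθ'.mul bΦr).integrable.const_mul _)).add ((bθ'.mul bΦc).integrable.const_mul _))]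
    refine intervalIntegral.integral_congr fun t _ => ?_
    simp only [energy, repPot, cohPot]
    rw [← integral_const_mul, ← integral_const_mul]
    refine integral_congr_ae (Eventually.of_forall fun x => ?_)
    ring
  have e2 : ∫ t in M.t₀..M.t_f, θ t * M.power (ρ t) (j t) =
      ∫ p, θ p.1 * M.powerDensity (ρ p.1) (j p.1) p.2 ∂M.qm := by
    rw [hM.integral_qm (bθ.mul bpw).integrable]
    refine intervalIntegral.integral_congr fun t _ => ?_
    simp only [integral_const_mul]
    rfl
  have ht₀ := left_mem_Icc.2 hM.time_lt.le
  have br₀ := hl.essBounded_slice hM ht₀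
  have e3 : M.energy (ρ M.t₀) (j M.t₀) =
      1 / 2 * (∫ x in M.D, (ρ M.t₀ x)⁻¹ * ‖j M.t₀ x‖ ^ 2)
      + 1 / 2 * (∫ x in M.D, ρ M.t₀ x * potential M.D M.k_r M.l_r (ρ M.t₀) x)
      + 1 / 2 * ∫ x in M.D, ρ M.t₀ x * potential M.D M.k_c M.l_c (ρ M.t₀) x := by
    rw [energy, ← mul_add, ← mul_add, ← integral_add₃
      (((hρ.lipSlab_inv hM).essBounded_slice hM ht₀).mul hj₀.norm_sq).integrable
      (br₀.mul ((hl.potential hM M.k_r M.l_r).essBounded_slice hM ht₀)).integrable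
      (br₀.mul ((hl.potential hM M.k_c M.l_c).essBounded_slice hM ht₀)).integrable]
    rfl
  rw [e1, e2, e3] at key
  -- The weighted potential energies in `key` are exactly the weighted work of the potential forces
  -- on `j`, so only kinetic energy remains.
  rw [integral_weight_fderiv_potential hM hρ hj hc M.k_r M.l_r hθ hf,
    integral_weight_fderiv_potential hM hρ hj hc M.k_c M.l_c hθ hf]
  linarith

/-- The weak equations of `j` tested with the velocity of the Lipschitz solution. -/
theorem weak_equations_velocity (hM : M.Admissible) (hρ : M.IsDensity ρ)
    (hi : M.IsLipschitzSolution j₀ ρ i) (hj : M.IsMomentum j) (hc : M.WeakContinuity ρ j)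
    (hm : M.WeakMomentum ρ j) (h₀ : ∀ᵐ x ∂M.xm, j M.t₀ x = i M.t₀ x)
    {v : ℝ × R3 → R3} (hv : v = fun p => (ρ p.1 p.2)⁻¹ • i p.1 p.2)
    {θ : ℝ → ℝ} (hθ : ContDiff ℝ 1 θ) (hf : θ M.t_f = 0) :
    θ M.t₀ * (1 / 2 * ∫ x in M.D, (ρ M.t₀ x)⁻¹ * ‖j M.t₀ x‖ ^ 2) =
      ∫ p, (θ p.1 * (⟪v p - (ρ p.1 p.2)⁻¹ • j p.1 p.2, fderiv ℝ v p (ρ p.1 p.2, j p.1 p.2)⟫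
          - ⟪v p, M.source (ρ p.1) (j p.1) p.2⟫)
        + deriv θ p.1 * (ρ p.1 p.2 * (1 / 2 * ‖v p‖ ^ 2 -
          ⟪(ρ p.1 p.2)⁻¹ • j p.1 p.2, v p⟫))) ∂M.qm := by
  have := hM.isFiniteMeasure_xm
  have := hM.isFiniteMeasure_qm
  have lv : M.LipSlab v := hv ▸ hi.lipSlab_velocity hM hρ
  have lθ := lipSlab_weight hM hθ
  have lv2 : M.LipSlab fun p => 1 / 2 * ‖v p‖ ^ 2 :=
    lv.comp hM (g := fun u : R3 => 1 / 2 * ‖u‖ ^ 2)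
      ((contDiff_norm_sq ℝ).const_smul (1 / 2 : ℝ))
  have bS := essBounded_source hM hρ hj.essBounded
  have bX : EssBounded M.qm fun p => (ρ p.1 p.2, j p.1 p.2) :=
    (hρ.lipSlab.essBounded hM).prodMk hj.essBounded
  have bw : EssBounded M.qm fun p => (ρ p.1 p.2)⁻¹ • j p.1 p.2 :=
    ((hρ.lipSlab_inv hM).essBounded hM).smul hj.essBounded
  have l1 := lθ.smul hM lv2
  have l2 := lθ.smul hM lv
  -- The test functions are `θ ‖v‖²/2` for continuity and `θ v` for momentum; subtracting the two
  -- identities gives the claim.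
  have hC := hc.lipschitz hM hρ hj l1
  have hW := hm.lipschitz hM hρ hj bS l2
  have i1 := ((l1.essBounded_fderiv hM).clm_apply bX).integrable
  have i2 := ((bw.inner ((l2.essBounded_fderiv hM).clm_apply bX)).add
    ((l2.essBounded hM).inner bS)).integrable
  have e : ∫ p, (θ p.1 * (⟪v p - (ρ p.1 p.2)⁻¹ • j p.1 p.2, fderiv ℝ v p (ρ p.1 p.2, j p.1 p.2)⟫
          - ⟪v p, M.source (ρ p.1) (j p.1) p.2⟫)
        + deriv θ p.1 * (ρ p.1 p.2 * (1 / 2 * ‖v p‖ ^ 2 -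
          ⟪(ρ p.1 p.2)⁻¹ • j p.1 p.2, v p⟫))) ∂M.qm =
      (∫ p, fderiv ℝ (fun p => θ p.1 • (1 / 2 * ‖v p‖ ^ 2)) p (ρ p.1 p.2, j p.1 p.2) ∂M.qm)
      - ∫ p, (⟪(ρ p.1 p.2)⁻¹ • j p.1 p.2,
          fderiv ℝ (fun p => θ p.1 • v p) p (ρ p.1 p.2, j p.1 p.2)⟫
        + ⟪θ p.1 • v p, M.source (ρ p.1) (j p.1) p.2⟫) ∂M.qm := by
    rw [← integral_sub i1 i2]
    refine integral_congr_ae ?_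
    filter_upwards [lv.ae_differentiableAt hM] with p hp
    have d2 : HasFDerivAt (fun p => 1 / 2 * ‖v p‖ ^ 2) _ p :=
      (hp.hasFDerivAt.norm_sq).const_mul (1 / 2 : ℝ)
    rw [fderiv_weight_smul hθ hp, fderiv_weight_smul hθ d2.differentiableAt, d2.fderiv]
    simp only [smul_apply, ContinuousLinearMap.comp_apply, innerSL_apply_apply, smul_eq_mul,
      inner_add_right, inner_sub_left, real_inner_smul_right, real_inner_smul_left]
    ring
  rw [e, ← hC, ← hW]
  have ht₀ := left_mem_Icc.2 hM.time_lt.le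
  -- Initially `v = ρ⁻¹ j`, so half of the initial mixed term survives; the terms at `t_f` vanish
  -- with `θ`.
  have a1 : ∫ x in M.D, ρ M.t₀ x * (θ M.t₀ • (1 / 2 * ‖v (M.t₀, x)‖ ^ 2)) =
      θ M.t₀ * (1 / 2 * ∫ x in M.D, (ρ M.t₀ x)⁻¹ * ‖j M.t₀ x‖ ^ 2) := by
    rw [← integral_const_mul, ← integral_const_mul]
    refine integral_congr_ae ?_
    filter_upwards [h₀, hM.ae_mem_slab ht₀] with x hx hx'
    have hp := hρ.pos M.t₀ ht₀ x hx'.2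
    simp only [hv, hx, norm_smul, norm_inv, Real.norm_of_nonneg hp.le, smul_eq_mul]
    field_simp
  have a2 : ∫ x in M.D, ⟪j M.t₀ x, θ M.t₀ • v (M.t₀, x)⟫ =
      θ M.t₀ * ∫ x in M.D, (ρ M.t₀ x)⁻¹ * ‖j M.t₀ x‖ ^ 2 := by
    rw [← integral_const_mul]
    refine integral_congr_ae ?_
    filter_upwards [h₀] with x hx
    simp only [hv, hx, real_inner_smul_right, real_inner_self_eq_norm_sq]
  simp only [hf, zero_smul, mul_zero, inner_zero_right, integral_zero, zero_sub, a1, a2]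
  ring

/-- The relative energy inequality, tested with a decreasing weight. -/
theorem relative_energy_inequality (hM : M.Admissible) (hρ : M.IsDensity ρ)
    (hi : M.IsLipschitzSolution j₀ ρ i) (hj : M.IsMomentum j) (hc : M.WeakContinuity ρ j)
    (hm : M.WeakMomentum ρ j) (he : M.EnergyInequality ρ j)
    (h₀ : ∀ᵐ x ∂M.xm, j M.t₀ x = i M.t₀ x)
    {v w : ℝ × R3 → R3} (hv : v = fun p => (ρ p.1 p.2)⁻¹ • i p.1 p.2)
    (hw : w = fun p => (ρ p.1 p.2)⁻¹ • j p.1 p.2)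
    {θ : ℝ → ℝ} (hθ : ContDiff ℝ 1 θ) (hf : θ M.t_f = 0) (hd : ∀ t, deriv θ t ≤ 0) :
    ∫ p, -deriv θ p.1 * (1 / 2 * (ρ p.1 p.2 * ‖v p - w p‖ ^ 2)) ∂M.qm ≤
      ∫ p, θ p.1 * (ρ p.1 p.2 * ⟪v p - w p, M.alignPot (i p.1) p.2 - M.alignPot (j p.1) p.2⟫
        - ρ p.1 p.2 * ‖v p - w p‖ ^ 2 * M.alignPot (ρ p.1) p.2
        + ρ p.1 p.2 * ⟪v p - w p, (M.κ_p * (1 - M.P ‖v p‖)) • v p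
            - (M.κ_p * (1 - M.P ‖w p‖)) • w p⟫
        + ⟪v p - w p, fderiv ℝ v p (0, j p.1 p.2 - i p.1 p.2)⟫) ∂M.qm := by
  have := hM.isFiniteMeasure_xm
  have := hM.isFiniteMeasure_qm
  have ht₀ := left_mem_Icc.2 hM.time_lt.le
  have hj₀ : EssBounded M.xm (j M.t₀) :=
    (hi.lipSlab.essBounded_slice hM ht₀).congr (h₀.mono fun _ h => h.symm)
  have hE := he.weighted hM hρ hj hc hj₀ hθ hf hd
  have hV := weak_equations_velocity hM hρ hi hj hc hm h₀ hv hθ hf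
  rw [hV] at hE
  have hl := hρ.lipSlab
  have br := hl.essBounded hM
  have lv : M.LipSlab v := hv ▸ hi.lipSlab_velocity hM hρ
  have bv := lv.essBounded hM
  have bw : EssBounded M.qm w := hw ▸ ((hρ.lipSlab_inv hM).essBounded hM).smul hj.essBounded
  have bX : EssBounded M.qm fun p => (ρ p.1 p.2, j p.1 p.2) := br.prodMk hj.essBounded
  have b0j : EssBounded M.qm fun p => ((0 : ℝ), j p.1 p.2) :=
    (EssBounded.const _).prodMk hj.essBounded
  have bS := essBounded_source hM hρ hj.essBounded
  have bk := (EssBounded.const (1 / 2 : ℝ)).mul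
    (((hρ.lipSlab_inv hM).essBounded hM).mul hj.essBounded.norm_sq)
  have bpw := essBounded_powerDensity hM hρ hj.essBounded
  have bθ := (lipSlab_weight hM hθ).essBounded hM
  have bθ' : EssBounded M.qm fun p => deriv θ p.1 :=
    (LipSlab.fst.essBounded hM).comp (hθ.continuous_deriv le_rfl)
  have lr := hl.potential hM M.k_r M.l_r
  have lc := hl.potential hM M.k_c M.l_c
  have bΦr := bθ.mul ((lr.essBounded_fderiv hM).clm_apply b0j)
  have bΦc := bθ.mul ((lc.essBounded_fderiv hM).clm_apply b0j)
  have bB : EssBounded M.qm fun p =>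
      (θ p.1 * (⟪v p - (ρ p.1 p.2)⁻¹ • j p.1 p.2, fderiv ℝ v p (ρ p.1 p.2, j p.1 p.2)⟫
          - ⟪v p, M.source (ρ p.1) (j p.1) p.2⟫)
        + deriv θ p.1 * (ρ p.1 p.2 * (1 / 2 * ‖v p‖ ^ 2 -
          ⟪(ρ p.1 p.2)⁻¹ • j p.1 p.2, v p⟫))) := by
    rw [hw] at bw
    exact (bθ.mul (((bv.sub bw).inner ((lv.essBounded_fderiv hM).clm_apply bX)).sub
      (bv.inner bS))).add
      (bθ'.mul (br.mul (((EssBounded.const (1 / 2 : ℝ)).mul bv.norm_sq).sub (bw.inner bv))))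
  have i1 := (bθ'.mul bk).integrable
  have i2 := bB.integrable
  have i3 := bΦr.integrable
  have i4 := bΦc.integrable
  have i5 := (bθ.mul bpw).integrable
  have iL := (bθ'.neg.mul ((EssBounded.const (1 / 2 : ℝ)).mul
    (br.mul (bv.sub bw).norm_sq))).integrable
  have hsum := integral_sub' (((i5.add i1).add i2).sub i3) i4
  rw [integral_sub' ((i5.add i1).add i2) i3, integral_add' (i5.add i1) i2,
    integral_add' i5 i1] at hsum
  have iS := (((i5.add i1).add i2).sub i3).sub i4
  -- The added term is the slack in `hE`, nonnegative by `hE`; what is left is an identity of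
  -- integrands, checked pointwise.
  refine le_of_le_of_eq (b := (∫ p, -deriv θ p.1 * (1 / 2 * (ρ p.1 p.2 * ‖v p - w p‖ ^ 2)) ∂M.qm)
    + _) (le_add_of_nonneg_right ?_) ((integral_add iL iS).symm.trans (integral_congr_ae ?_))
  · refine le_of_le_of_eq ?_ hsum.symm
    linarith
  filter_upwards [hρ.ae_pos hM, hi.fderiv_velocity hM hρ, lr.ae_differentiableAt hM,
    lc.ae_differentiableAt hM] with p hp hS hr hc
  have hjw : j p.1 p.2 = ρ p.1 p.2 • w p := by rw [hw, smul_inv_smul₀ hp.ne']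
  have hiv : i p.1 p.2 = ρ p.1 p.2 • v p := by rw [hv, smul_inv_smul₀ hp.ne']
  have hPj : (ρ p.1 p.2)⁻¹ * ‖j p.1 p.2‖ = ‖w p‖ := by
    rw [hw, norm_smul, norm_inv, Real.norm_of_nonneg hp.le]
  have hPi : (ρ p.1 p.2)⁻¹ * ‖i p.1 p.2‖ = ‖v p‖ := by
    rw [hv, norm_smul, norm_inv, Real.norm_of_nonneg hp.le]
  have hwp : (ρ p.1 p.2)⁻¹ • j p.1 p.2 = w p := by rw [hw]
  have hgr := inner_gradient_slice (f := fun t => potential M.D M.k_r M.l_r (ρ t)) hr (j p.1 p.2)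
  have hgc := inner_gradient_slice (f := fun t => potential M.D M.k_c M.l_c (ρ t)) hc (j p.1 p.2)
  -- Transport of `v` along `j` is transport along `i`, given by the strong equation, plus an error
  -- linear in `j - i`.
  have hA : fderiv ℝ v p (ρ p.1 p.2, j p.1 p.2) = M.source (ρ p.1) (i p.1) p.2
      + fderiv ℝ v p (0, j p.1 p.2 - i p.1 p.2) := by
    rw [← hS, ← hv, ← map_add]
    simp
  have key := relative_energy_identity hp (M.alignPot (ρ p.1) p.2) M.κ_p (M.P ‖v p‖) (M.P ‖w p‖)
    (v p) (w p) (M.alignPot (i p.1) p.2) (M.alignPot (j p.1) p.2)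
    (gradient (M.cohPot (ρ p.1)) p.2) (gradient (M.repPot (ρ p.1)) p.2) (gradient M.U p.2)
    (fderiv ℝ v p (0, j p.1 p.2 - i p.1 p.2))
  rw [← hjw, ← hiv] at key
  have hnorm : 1 / 2 * ((ρ p.1 p.2)⁻¹ * ‖j p.1 p.2‖ ^ 2) +
      ρ p.1 p.2 * (1 / 2 * ‖v p‖ ^ 2 - ⟪w p, v p⟫) = 1 / 2 * (ρ p.1 p.2 * ‖v p - w p‖ ^ 2) := by
    rw [hjw, norm_smul, Real.norm_of_nonneg hp.le, norm_sub_sq_real, real_inner_comm]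
    field_simp
    ring
  simp only [Pi.add_apply, Pi.sub_apply]
  rw [hA, hwp, powerDensity, hwp]
  simp only [source, hPi, hPj]
  change _ = fderiv ℝ (fun p : ℝ × R3 => potential M.D M.k_r M.l_r (ρ p.1) p.2) p _ at hgr
  change _ = fderiv ℝ (fun p : ℝ × R3 => potential M.D M.k_c M.l_c (ρ p.1) p.2) p _ at hgc
  rw [← hgr, ← hgc]
  simp only [cohPot, repPot] at key ⊢
  linear_combination θ p.1 * key + deriv θ p.1 * hnorm

theorem ae_fst (hM : M.Admissible) {P : ℝ → Prop} (h : ∀ᵐ t ∂M.tm, P t) :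
    ∀ᵐ p ∂M.qm, P p.1 := by
  have := hM.isFiniteMeasure_xm
  rw [qm_eq_prod]
  exact Measure.quasiMeasurePreserving_fst.ae h

theorem alignPot_density_nonneg (hM : M.Admissible) (hρ : M.IsDensity ρ) {t : ℝ}
    (ht : t ∈ Icc M.t₀ M.t_f) (x : R3) : 0 ≤ M.alignPot (ρ t) x :=
  setIntegral_nonneg hM.isOpen_D.measurableSet fun y hy =>
    smul_nonneg (yukawa_nonneg hM.k_a_pos.le _ _) (hρ.pos t ht y (subset_closure hy)).le

/-- Schur's test for the Yukawa kernel, integrated in time against a nonnegative weight. -/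
theorem exists_integral_weight_inner_potential_le (hM : M.Admissible) (k l : ℝ) :
    ∃ C, 0 ≤ C ∧ ∀ (a : ℝ → R3 → R3) (θ : ℝ → ℝ), EssBounded M.qm (fun p => a p.1 p.2) →
      ContDiff ℝ 1 θ → (∀ t ≤ M.t_f, 0 ≤ θ t) →
      ∫ p, θ p.1 * ⟪a p.1 p.2, potential M.D k l (a p.1) p.2⟫ ∂M.qm ≤
        C * ∫ p, θ p.1 * ‖a p.1 p.2‖ ^ 2 ∂M.qm := by
  have := hM.isFiniteMeasure_qm
  obtain ⟨C, hC0, hC⟩ := exists_integral_inner_potential_le hM k l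
  refine ⟨C, hC0, fun a θ ha hθ hθ0 => ?_⟩
  have bθ := (lipSlab_weight hM hθ).essBounded hM
  have b1 := bθ.mul (ha.inner (ha.potential hM k l))
  have b2 := bθ.mul ha.norm_sq
  rw [hM.integral_qm b1.integrable, hM.integral_qm b2.integrable,
    ← intervalIntegral.integral_const_mul]
  have h1 := intervalIntegrable_integral hM b1
  have h2 := (intervalIntegrable_integral hM b2).const_mul C
  rw [intervalIntegral.integral_of_le hM.time_lt.le, intervalIntegral.integral_of_le hM.time_lt.le,
    integral_Ioc_eq_integral_Ioo, integral_Ioc_eq_integral_Ioo]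
  rw [intervalIntegrable_iff_integrableOn_Ioo_of_le hM.time_lt.le] at h1 h2
  refine integral_mono_ae h1 h2 ?_
  filter_upwards [ha.ae_slice hM, ae_restrict_mem measurableSet_Ioo] with t ht ht'
  simp only [integral_const_mul]
  rw [mul_left_comm]
  exact mul_le_mul_of_nonneg_left (hC _ ht) (hθ0 t ht'.2.le)

/-- The relative energy is controlled by its time integral. -/
theorem exists_relative_energy_bound (hM : M.Admissible) (hρ : M.IsDensity ρ)
    (hi : M.IsLipschitzSolution j₀ ρ i) (hj : M.IsMomentum j) (hc : M.WeakContinuity ρ j)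
    (hm : M.WeakMomentum ρ j) (he : M.EnergyInequality ρ j)
    (h₀ : ∀ᵐ x ∂M.xm, j M.t₀ x = i M.t₀ x)
    {v w : ℝ × R3 → R3} (hv : v = fun p => (ρ p.1 p.2)⁻¹ • i p.1 p.2)
    (hw : w = fun p => (ρ p.1 p.2)⁻¹ • j p.1 p.2) :
    ∃ C : ℝ, 0 ≤ C ∧ ∀ θ : ℝ → ℝ, ContDiff ℝ 1 θ → θ M.t_f = 0 → (∀ t, deriv θ t ≤ 0) →
      (∀ t ≤ M.t_f, 0 ≤ θ t) →
      ∫ p, -deriv θ p.1 * (1 / 2 * (ρ p.1 p.2 * ‖v p - w p‖ ^ 2)) ∂M.qm ≤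
        C * ∫ p, θ p.1 * (ρ p.1 p.2 * ‖v p - w p‖ ^ 2) ∂M.qm := by
  have := hM.isFiniteMeasure_qm
  have hl := hρ.lipSlab
  have br := hl.essBounded hM
  have lv : M.LipSlab v := hv ▸ hi.lipSlab_velocity hM hρ
  have bv := lv.essBounded hM
  have bw : EssBounded M.qm w := hw ▸ ((hρ.lipSlab_inv hM).essBounded hM).smul hj.essBounded
  have ba : EssBounded M.qm fun p => i p.1 p.2 - j p.1 p.2 :=
    (hi.lipSlab.essBounded hM).sub hj.essBounded
  obtain ⟨R, hR⟩ := br.bound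
  obtain ⟨Kv, hKv⟩ := (lv.essBounded_fderiv hM).bound
  obtain ⟨L, hL⟩ := hM.propulsion_lip
  obtain ⟨Cs, hCs0, hCs⟩ := exists_integral_weight_inner_potential_le hM M.k_a M.l_a
  -- Alignment costs `Cs * max R 0`, because `‖i - j‖² = ρ² ‖v - w‖²` and `ρ ≤ R`; self-propulsion
  -- costs `L` and transport `Kv`. The maxima with 0 only secure signs.
  refine ⟨Cs * max R 0 + (L + max Kv 0), by positivity, fun θ hθ hf hd hθ0 => ?_⟩
  have bθ := (lipSlab_weight hM hθ).essBounded hM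
  have bY := bθ.mul (br.mul (bv.sub bw).norm_sq)
  have hs := hCs (fun t x => i t x - j t x) θ ba hθ hθ0
  have b1 := bθ.mul (ba.inner (ba.potential (a := fun t x => i t x - j t x) hM M.k_a M.l_a))
  have hbase : ∀ᵐ p ∂M.qm, i p.1 p.2 - j p.1 p.2 = ρ p.1 p.2 • (v p - w p) := by
    filter_upwards [hρ.ae_pos hM] with p hp
    rw [hv, hw, smul_sub, smul_inv_smul₀ hp.ne', smul_inv_smul₀ hp.ne']
  have hsq : ∫ p, θ p.1 * ‖i p.1 p.2 - j p.1 p.2‖ ^ 2 ∂M.qm ≤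
      max R 0 * ∫ p, θ p.1 * (ρ p.1 p.2 * ‖v p - w p‖ ^ 2) ∂M.qm := by
    rw [← integral_const_mul]
    refine integral_mono_ae (bθ.mul ba.norm_sq).integrable (bY.integrable.const_mul _) ?_
    filter_upwards [hbase, hR, hρ.ae_pos hM, hM.ae_mem] with p hp hpR hpos hmem
    have hθp := hθ0 p.1 hmem.1.2.le
    have hRp : ρ p.1 p.2 ≤ max R 0 := (le_abs_self _).trans (hpR.trans (le_max_left _ _))
    beta_reduce
    rw [hp, norm_smul, Real.norm_of_nonneg hpos.le]
    have : θ p.1 * (ρ p.1 p.2 * ‖v p - w p‖) ^ 2 =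
      ρ p.1 p.2 * (θ p.1 * (ρ p.1 p.2 * ‖v p - w p‖ ^ 2)) := by ring
    rw [this]
    exact mul_le_mul_of_nonneg_right hRp (by positivity)
  refine (relative_energy_inequality hM hρ hi hj hc hm he h₀ hv hw hθ hf hd).trans ?_
  have hsum := integral_add b1.integrable (bY.integrable.const_mul (L + max Kv 0))
  rw [integral_const_mul] at hsum
  have hfin : (∫ p, θ p.1 * (ρ p.1 p.2 * ‖v p - w p‖ ^ 2) ∂M.qm) * (Cs * max R 0) ≥
      ∫ p, θ p.1 * ⟪i p.1 p.2 - j p.1 p.2,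
        potential M.D M.k_a M.l_a (fun x => i p.1 x - j p.1 x) p.2⟫ ∂M.qm := by
    have := mul_le_mul_of_nonneg_left hsq hCs0
    linarith
  refine le_trans ?_ (hsum.le.trans (by linarith))
  have bL : EssBounded M.qm fun p => θ p.1 * (ρ p.1 p.2 * ⟪v p - w p,
        M.alignPot (i p.1) p.2 - M.alignPot (j p.1) p.2⟫
        - ρ p.1 p.2 * ‖v p - w p‖ ^ 2 * M.alignPot (ρ p.1) p.2
        + ρ p.1 p.2 * ⟪v p - w p, (M.κ_p * (1 - M.P ‖v p‖)) • v p
            - (M.κ_p * (1 - M.P ‖w p‖)) • w p⟫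
        + ⟪v p - w p, fderiv ℝ v p (0, j p.1 p.2 - i p.1 p.2)⟫) := by
    have bvw := bv.sub bw
    have bF : ∀ {u : ℝ × R3 → R3}, EssBounded M.qm u →
        EssBounded M.qm fun p => (M.κ_p * (1 - M.P ‖u p‖)) • u p := fun hu =>
      hu.comp (g := fun v : R3 => (M.κ_p * (1 - M.P ‖v‖)) • v) hL.continuous
    exact bθ.mul ((((br.mul (bvw.inner (((hi.lipSlab.essBounded hM).potential hM _ _).sub
      (hj.essBounded.potential hM _ _)))).sub ((br.mul bvw.norm_sq).mul
      (br.potential hM M.k_a M.l_a))).add (br.mul (bvw.inner ((bF bv).sub (bF bw))))).add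
      (bvw.inner ((lv.essBounded_fderiv hM).clm_apply ((EssBounded.const (0 : ℝ)).prodMk
        (hj.essBounded.sub (hi.lipSlab.essBounded hM))))))
  refine integral_mono_ae bL.integrable
    (b1.integrable.add (bY.integrable.const_mul (L + max Kv 0))) ?_
  filter_upwards [hbase, hKv, hρ.ae_pos hM, hM.ae_mem,
    ae_fst hM ((hi.lipSlab.essBounded hM).ae_slice hM), ae_fst hM (hj.essBounded.ae_slice hM)]
    with p hp hpK hpos hmem hsi hsj
  have hθp := hθ0 p.1 hmem.1.2.le
  have hπ := potential_sub hM M.k_a M.l_a hsi hsj (subset_closure hmem.2)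
  -- The damping part of the alignment enters with a minus sign and is simply dropped.
  have hT2 : 0 ≤ ρ p.1 p.2 * ‖v p - w p‖ ^ 2 * M.alignPot (ρ p.1) p.2 :=
    mul_nonneg (by positivity)
      (alignPot_density_nonneg hM hρ (Ioo_subset_Icc_self hmem.1) p.2)
  have hT3 : ⟪v p - w p, (M.κ_p * (1 - M.P ‖v p‖)) • v p - (M.κ_p * (1 - M.P ‖w p‖)) • w p⟫ ≤
      L * ‖v p - w p‖ ^ 2 := by
    refine (real_inner_le_norm _ _).trans ?_
    have h := hL.dist_le_mul (v p) (w p)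
    rw [dist_eq_norm, dist_eq_norm] at h
    calc _ ≤ ‖v p - w p‖ * (L * ‖v p - w p‖) := mul_le_mul_of_nonneg_left h (norm_nonneg _)
      _ = _ := by ring
  have hT4 : ⟪v p - w p, fderiv ℝ v p (0, j p.1 p.2 - i p.1 p.2)⟫ ≤
      max Kv 0 * (ρ p.1 p.2 * ‖v p - w p‖ ^ 2) := by
    refine (real_inner_le_norm _ _).trans ?_
    have h := (fderiv ℝ v p).le_of_opNorm_le (hpK.trans (le_max_left Kv 0))
      (0, j p.1 p.2 - i p.1 p.2)
    have hn : ‖((0 : ℝ), j p.1 p.2 - i p.1 p.2)‖ = ρ p.1 p.2 * ‖v p - w p‖ := by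
      rw [Prod.norm_mk, norm_zero, max_eq_right (norm_nonneg _), norm_sub_rev, hp, norm_smul,
        Real.norm_of_nonneg hpos.le]
    rw [hn] at h
    calc _ ≤ ‖v p - w p‖ * (max Kv 0 * (ρ p.1 p.2 * ‖v p - w p‖)) :=
          mul_le_mul_of_nonneg_left h (norm_nonneg _)
      _ = _ := by ring
  have hT3' := mul_le_mul_of_nonneg_left hT3 hpos.le
  beta_reduce
  rw [mul_left_comm _ (θ p.1), ← mul_add]
  refine mul_le_mul_of_nonneg_left ?_ hθp
  rw [hπ, hp, real_inner_smul_left]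
  simp only [alignPot] at hT2 ⊢
  linarith

/-- The weight `e^{-ct} - e^{-cb}`. -/
theorem exists_weight (b C : ℝ) (hC : 0 ≤ C) :
    ∃ θ : ℝ → ℝ, ContDiff ℝ 1 θ ∧ θ b = 0 ∧ (∀ t, deriv θ t ≤ 0) ∧ (∀ t ≤ b, 0 ≤ θ t) ∧
      ∀ t, 0 < -deriv θ t * (1 / 2) - C * θ t := by
  -- With this rate, `-θ'/2 - C θ` equals `e^{-ct} + C e^{-cb}`.
  set c := 2 * C + 2
  have hc : 0 < c := by positivity
  have hd : ∀ t, deriv (fun t => Real.exp (-(c * t)) - Real.exp (-(c * b))) t =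
      -(c * Real.exp (-(c * t))) := fun t => by
    have h : HasDerivAt (fun t : ℝ => Real.exp (-(c * t)) - Real.exp (-(c * b)))
        (Real.exp (-(c * t)) * (-(c * 1))) t :=
      (((hasDerivAt_id t).const_mul c).neg.exp).sub_const _
    rw [h.deriv]
    ring
  refine ⟨fun t => Real.exp (-(c * t)) - Real.exp (-(c * b)), by fun_prop, sub_self _,
    fun t => ?_, fun t ht => ?_, fun t => ?_⟩
  · rw [hd]
    have := Real.exp_pos (-(c * t))
    nlinarith
  · rw [sub_nonneg, Real.exp_le_exp]
    nlinarith
  · rw [hd]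
    have h1 := Real.exp_pos (-(c * t))
    have h2 := Real.exp_pos (-(c * b))
    simp only [c] at *
    nlinarith [mul_nonneg hC h2.le]

end System

end EulerAlignment

end

theorem mainTheorem3 (M : EulerAlignment.System) (hM : M.Admissible)
    (ρ₀ : EulerAlignment.R3 → ℝ) (j₀ : EulerAlignment.R3 → EulerAlignment.R3)
    (h₀ : M.IsInitialData ρ₀ j₀)
    (ρ : ℝ → EulerAlignment.R3 → ℝ) (hρ : M.IsDensity ρ)
    (hρ₀ : ∀ x ∈ M.D, ρ M.t₀ x = ρ₀ x)
    (i : ℝ → EulerAlignment.R3 → EulerAlignment.R3)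
    (hi : M.IsLipschitzSolution j₀ ρ i)
    (j : ℝ → EulerAlignment.R3 → EulerAlignment.R3)
    (hj : M.IsBoundedEnergyWeakSolution ρ₀ j₀ ρ j) :
    ∀ᵐ p ∂((volume : Measure (ℝ × EulerAlignment.R3)).restrict (Icc M.t₀ M.t_f ×ˢ M.D)),
      j p.1 p.2 = i p.1 p.2 := by
  have := hM.isFiniteMeasure_qm
  have hset : (Icc M.t₀ M.t_f ×ˢ M.D : Set (ℝ × EulerAlignment.R3)) =ᵐ[volume]
      (Ioo M.t₀ M.t_f ×ˢ M.D : Set (ℝ × EulerAlignment.R3)) :=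
    Measure.set_prod_ae_eq Ioo_ae_eq_Icc.symm (ae_eq_refl _)
  rw [Measure.restrict_congr_set hset]
  change ∀ᵐ p ∂M.qm, _
  have h₀' : ∀ᵐ x ∂M.xm, j M.t₀ x = i M.t₀ x := by
    filter_upwards [hj.initial_momentum, ae_restrict_mem hM.isOpen_D.measurableSet] with x hx hx'
    rw [hx, hi.initial x hx']
  obtain ⟨C, hC0, hC⟩ := EulerAlignment.System.exists_relative_energy_bound hM hρ hi hj.momentum
    hj.continuity_eq hj.momentum_eq hj.energy_ineq h₀' rfl rfl
  obtain ⟨θ, hθ, hf, hd, hθ0, hpos⟩ := EulerAlignment.System.exists_weight M.t_f C hC0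
  have key := hC θ hθ hf hd hθ0
  have br := hρ.lipSlab.essBounded hM
  have bi := (hρ.lipSlab_inv hM).essBounded hM
  have bY := br.mul ((bi.smul (hi.lipSlab.essBounded hM)).sub
    (bi.smul hj.momentum.essBounded)).norm_sq
  have bθ := (EulerAlignment.System.lipSlab_weight hM hθ).essBounded hM
  have bθ' : EulerAlignment.EssBounded M.qm fun p => deriv θ p.1 :=
    (EulerAlignment.System.LipSlab.fst.essBounded hM).comp (hθ.continuous_deriv le_rfl)
  set Y : ℝ × EulerAlignment.R3 → ℝ := fun p =>
    ρ p.1 p.2 * ‖(ρ p.1 p.2)⁻¹ • i p.1 p.2 - (ρ p.1 p.2)⁻¹ • j p.1 p.2‖ ^ 2 with hY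
  have i1 := (bθ'.neg.mul ((EulerAlignment.EssBounded.const (1 / 2 : ℝ)).mul bY)).integrable
  have i2 := (bθ.mul bY).integrable.const_mul C
  have hle : ∫ p, (-deriv θ p.1 * (1 / 2 * Y p) - C * (θ p.1 * Y p)) ∂M.qm ≤ 0 := by
    rw [integral_sub i1 i2, integral_const_mul]
    linarith
  -- The integrand is `Y` times the strictly positive function provided by the weight, so a
  -- nonpositive integral forces `Y = 0` almost everywhere.
  have hnn : 0 ≤ᵐ[M.qm] fun p => -deriv θ p.1 * (1 / 2 * Y p) - C * (θ p.1 * Y p) := by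
    filter_upwards [hρ.ae_pos hM] with p hp
    have hYp : 0 ≤ Y p := by positivity
    have := mul_nonneg (hpos p.1).le hYp
    simp only [Pi.zero_apply]
    linarith
  have hzero := (integral_eq_zero_iff_of_nonneg_ae hnn (i1.sub i2)).1
    (le_antisymm hle (integral_nonneg_of_ae hnn))
  filter_upwards [hzero, hρ.ae_pos hM] with p hp hp'
  have h1 : (-deriv θ p.1 * (1 / 2) - C * θ p.1) * Y p = 0 := by
    simp only [Pi.zero_apply] at hp
    linarith
  have h2 : Y p = 0 := (mul_eq_zero.1 h1).resolve_left (hpos p.1).ne'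
  have h3 : (ρ p.1 p.2)⁻¹ • i p.1 p.2 = (ρ p.1 p.2)⁻¹ • j p.1 p.2 := by
    have := (mul_eq_zero.1 h2).resolve_left hp'.ne'
    exact sub_eq_zero.1 (norm_eq_zero.1 (pow_eq_zero_iff (two_ne_zero) |>.1 this))
  exact (smul_right_injective _ (inv_ne_zero hp'.ne') h3).symm
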